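/- Let $k\ge 1$ be an integer. For integers $a,b$ and $z$ in the upper half plane $\mathbb H$ put $$S_{2k}(a,b)(z)=\sum_{c\equiv a\,(2)}\ \sum_{\substack{d\equiv b\,(2)\\ (c,d)=1}}\frac1{(cz+d)^{2k}},\qquad E_{2k}^{\pm}(z)=\tfrac12\bigl(S_{2k}(0,1)(z)\pm S_{2k}(1,0)(z)\bigr),$$ where $c,d$ run over integers and the inner sum is taken over $d$ (for $k\ge 2$ the double series converges absolutely; for $k=1$ this is Eisenstein summation). Let $q^t=e^{2\pi i tz}$, $\Theta_2(z)=q^{1/8}\sum_{n\in\mathbb Z}q^{n(n+1)/2}$, $\Theta_3(z)=\sum_{n\in\mathbb Z}q^{n^2/2}$, $\lambda=\Theta_2^4/\Theta_3^4$, and let $L(s,\chi_0)=\sum_{n\ge1,\ n\text{ odd}}n^{-s}$. Let $\Gamma(2)$ be the principal congruence subgroup of level $2$ of $\mathrm{SL}_2(\mathbb Z)$. Consider either $E_{2k}^{+}$ with $k\ge 2$, or $E_{2k}^{-}$ with $k\ge 1$. Then $E_{2k}^{\pm}$ is holomorphic on $\mathbb H$, vanishes to finite order at every point, has only finitely many zeros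 modulo $\Gamma(2)$, and $$\frac{(2\pi i)^{2k}}{4^k\,\Gamma(2k)\,L(2k,\chi_0)}=\pm 8k\mp 16\sum_{\tau\in\Gamma(2)\backslash\mathbb H}\mathrm{ord}_\tau(E_{2k}^{\pm})\,\frac1{\lambda(\tau)},$$ with the upper signs for $E_{2k}^+$ and the lower signs for $E_{2k}^-$, where the sum may be computed with any choice of representatives of the $\Gamma(2)$-orbits in $\mathbb H$. -/

import Mathlib

open scoped UpperHalfPlane

noncomputable section

namespace EvenEisenstein

/-- The sum `∑ (c z + d)^(-m)` over coprime integers `c ≡ a`, `d ≡ b` modulo `2`, with the sum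
over `d` taken first. For `m ≥ 3` the double series converges absolutely and the order does not
matter; for `m = 2` this is Eisenstein summation (both iterated sums converge absolutely). -/
def S (m : ℕ) (a b : ℤ) (z : ℂ) : ℂ :=
  ∑' c : ℤ, ∑' d : ℤ,
    if c ≡ a [ZMOD 2] ∧ d ≡ b [ZMOD 2] ∧ IsCoprime c d then 1 / ((c : ℂ) * z + d) ^ m else 0

/-- The even weight Eisenstein series `½ (S_{2k}(0,1) ± S_{2k}(1,0))` on `Γ(2)`; the sign `ε = ±1`
is a unit of `ℤ`. -/
def E (k : ℕ) (ε : ℤˣ) (z : ℂ) : ℂ :=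
  1 / 2 * (S (2 * k) 0 1 z + ((ε : ℤ) : ℂ) * S (2 * k) 1 0 z)

/-- The theta function `Θ₂(z) = q^(1/8) ∑ q^(n(n+1)/2)`, with `q^t = exp(2πitz)`. -/
def Theta2 (z : ℂ) : ℂ :=
  Complex.exp (2 * Real.pi * Complex.I * z / 8) *
    ∑' n : ℤ, Complex.exp (2 * Real.pi * Complex.I * z * ((n : ℂ) * (n + 1) / 2))

/-- The modular lambda function `Θ₂⁴ / Θ₃⁴`; Mathlib's `jacobiTheta z = ∑ exp(πi n² z)` is `Θ₃`. -/
def lam (z : ℂ) : ℂ := Theta2 z ^ 4 / jacobiTheta z ^ 4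

/-- The value `L(2k, χ₀) = ∑ n^(-2k)` over odd `n ≥ 1`, with `χ₀` the trivial character mod `2`. -/
def Lval (k : ℕ) : ℂ :=
  LSeries (fun n : ℕ => (1 : DirichletCharacter ℂ 2) (n : ZMod 2)) (2 * (k : ℂ))

/-- The set `Γ(2)\ℍ` of orbits of the principal congruence subgroup of level `2`. -/
abbrev Orbits : Type :=
  MulAction.orbitRel.Quotient (CongruenceSubgroup.Gamma 2) ℍ

end EvenEisenstein

end

section

open scoped UpperHalfPlane
open UpperHalfPlane hiding I
open Complex Filter Topology ModularForm MatrixGroups Manifold Asymptotics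
open scoped Real

namespace EvenEisenstein

/-! Write q_h = exp(πiτ). A modular form f of weight 2k for Γ(2) equals Θ₃^(4k) P(λ) for a
polynomial P (`IsMF.exists_polynomial`). The function λ has nowhere vanishing derivative
(`deriv_lam_ne_zero`) and induces a bijection from Γ(2)\ℍ onto ℂ∖{0, 1} (`exists_lam_eq`,
`exists_smul_eq_of_lam_eq`). As Θ₃ has no zeros on ℍ, the order of f at τ is the multiplicity of
λ(τ) as a root of P (`analyticOrderAt_eq_rootMultiplicity`). If P(0) and P(1) are nonzero, every
root is a value of λ, so the sum of ord/λ over the orbits is the sum of the reciprocals of the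
roots, which is −P'(0)/P(0) (`finsum_rootMultiplicity`).

Let C be the left side of the identity. The Fourier expansion gives E = 1 + εC q_h + o(q_h).
Comparison with Θ₃⁴ = 1 + 8q_h + … and λ = 16q_h + … yields P(0) = 1 and 8k + 16P'(0) = εC. The
action of S gives (−1)^k P(1 − λ) = εP(λ), hence P(1) ≠ 0. The theorem follows because ε² = 1.

The facts on theta functions come from level one: S and T permute Θ₂⁴, Θ₃⁴, Θ₄⁴ up to sign, cusp
forms of weight below 12 vanish, and those of weight 12 are multiples of the zero-free Δ.
Surjectivity of λ rests on the vanishing of forms of negative weight. Injectivity rests on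
Eisenstein series: λ(τ) and Θ₃⁴(τ) determine the power sums of (cτ+d)^(−2) over a residue class
modulo 2, hence the values themselves. The modularity of E is that of absolutely convergent
Eisenstein series for k ≥ 2, and for k = 1 it comes from differences of rescaled copies of G₂. -/

/-- The theta function `Θ₄(z) = ∑ (-1)ⁿ exp(πi n² z)`. -/
noncomputable def Theta4 (z : ℂ) : ℂ := jacobiTheta₂ (1 / 2) z

/-- `Θ₂⁴` on the upper half plane. -/
noncomputable def thX (τ : ℍ) : ℂ := Theta2 τ ^ 4

/-- `Θ₃⁴` on the upper half plane. -/
noncomputable def thY (τ : ℍ) : ℂ := jacobiTheta τ ^ 4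

/-- `Θ₄⁴` on the upper half plane. -/
noncomputable def thW (τ : ℍ) : ℂ := Theta4 τ ^ 4

lemma lam_eq_thX_div_thY (τ : ℍ) : lam τ = thX τ / thY τ := rfl

/-! ### Theta functions under the generators S and T. -/

lemma Theta2_eq_jacobiTheta₂ (z : ℂ) :
    Theta2 z = cexp (π * I * z / 4) * jacobiTheta₂ (z / 2) z := by
  unfold Theta2 jacobiTheta₂ jacobiTheta₂_term
  congr 1
  · congr 1; ring
  · exact tsum_congr fun n ↦ by congr 1; ring

lemma Theta4_eq_jacobiTheta_add_one (z : ℂ) : Theta4 z = jacobiTheta (z + 1) := by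
  unfold Theta4 jacobiTheta jacobiTheta₂ jacobiTheta₂_term
  refine tsum_congr fun n ↦ ?_
  obtain ⟨m, hm⟩ := Int.even_mul_pred_self n
  have hm' : (n : ℂ) ^ 2 = n + 2 * m := by
    have : n ^ 2 = n + 2 * m := by linarith [sq n, mul_sub n n 1]
    exact_mod_cast this
  rw [show (π * I * (n : ℂ) ^ 2 * (z + 1)) =
    2 * π * I * n * (1 / 2) + π * I * (n : ℂ) ^ 2 * z + m * (2 * π * I) by
      linear_combination (π * I) * hm']
  rw [exp_periodic.int_mul m]

lemma jacobiTheta_add_two (z : ℂ) : jacobiTheta (z + 2) = jacobiTheta z := by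
  rw [add_comm, jacobiTheta_two_add]

/-- Since n(n+1)/2 is an integer, the shift only changes the prefactor, by the eighth root of unity
exp(πi/4). -/
lemma Theta2_add_one_pow (z : ℂ) : Theta2 (z + 1) ^ 4 = -Theta2 z ^ 4 := by
  have h : Theta2 (z + 1) = cexp (π * I / 4) * Theta2 z := by
    unfold Theta2
    rw [← mul_assoc, ← Complex.exp_add]
    congr 1
    · congr 1; ring
    · refine tsum_congr fun n ↦ ?_
      obtain ⟨m, hm⟩ := Int.even_mul_succ_self n
      have hm' : (n : ℂ) * (n + 1) = 2 * m := by
        have : n * (n + 1) = 2 * m := by linarith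
        exact_mod_cast this
      rw [show 2 * π * I * (z + 1) * ((n : ℂ) * (n + 1) / 2) =
        2 * π * I * z * ((n : ℂ) * (n + 1) / 2) + m * (2 * π * I) by
          linear_combination (π * I) * hm', exp_periodic.int_mul m]
  rw [h, mul_pow, ← Complex.exp_nat_mul, show ((4 : ℕ) : ℂ) * (π * I / 4) = π * I by
    push_cast; ring, Complex.exp_pi_mul_I, neg_one_mul]

/-- The fourth power removes the branch of the square root from the functional equations. -/
lemma neg_I_mul_cpow_half_pow_four {τ : ℂ} : ((-I * τ) ^ (1 / 2 : ℂ)) ^ 4 = -τ ^ 2 := by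
  rw [← cpow_nat_mul, show ((4 : ℕ) : ℂ) * (1 / 2) = (2 : ℕ) by norm_num, cpow_natCast]
  linear_combination τ ^ 2 * I_sq

/-- This is the functional equation of `jacobiTheta₂` at (τ/2, τ), whose Gaussian factor cancels the
prefactor exp(πiτ/4) of Θ₂. -/
lemma Theta4_neg_inv_pow {τ : ℂ} (hτ : 0 < τ.im) :
    Theta4 (-1 / τ) ^ 4 = -τ ^ 2 * Theta2 τ ^ 4 := by
  have h0 : τ ≠ 0 := by rintro rfl; simp at hτ
  have h1 : (-I * τ) ^ (1 / 2 : ℂ) ≠ 0 := by simp [cpow_eq_zero_iff, h0]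
  have h : Theta4 (-1 / τ) = (-I * τ) ^ (1 / 2 : ℂ) * Theta2 τ := by
    rw [Theta2_eq_jacobiTheta₂, jacobiTheta₂_functional_equation, Theta4,
      show τ / 2 / τ = 1 / 2 by field_simp]
    have : cexp (π * I * τ / 4) * cexp (-π * I * (τ / 2) ^ 2 / τ) = 1 := by
      rw [← Complex.exp_add, ← Complex.exp_zero]; congr 1; field_simp; ring
    have h2 : (-I * τ) ^ (1 / 2 : ℂ) * (1 / (-I * τ) ^ (1 / 2 : ℂ)) = 1 := by field_simp
    linear_combination (-jacobiTheta₂ (1 / 2) (-1 / τ)) * this -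
      jacobiTheta₂ (1 / 2) (-1 / τ) * cexp (π * I * τ / 4) *
        cexp (-π * I * (τ / 2) ^ 2 / τ) * h2
  rw [h, mul_pow, neg_I_mul_cpow_half_pow_four]

lemma Theta2_neg_inv_pow {τ : ℂ} (hτ : 0 < τ.im) :
    Theta2 (-1 / τ) ^ 4 = -τ ^ 2 * Theta4 τ ^ 4 := by
  have h0 : τ ≠ 0 := by rintro rfl; simp at hτ
  have him : 0 < (-1 / τ).im := by
    rw [neg_div, neg_im, one_div, inv_im, neg_div, neg_neg]
    exact div_pos hτ (normSq_pos.mpr h0)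
  have := Theta4_neg_inv_pow him
  rw [show -1 / (-1 / τ) = τ by field_simp] at this
  rw [this]
  field_simp

lemma jacobiTheta_neg_inv_pow {τ : ℂ} (hτ : 0 < τ.im) :
    jacobiTheta (-1 / τ) ^ 4 = -τ ^ 2 * jacobiTheta τ ^ 4 := by
  have h := jacobiTheta_S_smul ⟨τ, hτ⟩
  rw [UpperHalfPlane.modular_S_smul] at h
  have h' : jacobiTheta (-1 / τ) = (-I * τ) ^ (1 / 2 : ℂ) * jacobiTheta τ := by
    convert! h using 2
    simp [neg_div, inv_neg]
  rw [h', mul_pow, neg_I_mul_cpow_half_pow_four]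

lemma slash_S_apply (k : ℤ) (f : ℍ → ℂ) (τ : ℍ) :
    (f ∣[k] ModularGroup.S) τ = f (ModularGroup.S • τ) * (τ : ℂ) ^ (-k) := by
  rw [SL_slash_apply, ModularGroup.denom_S]

lemma slash_T_apply (k : ℤ) (f : ℍ → ℂ) (τ : ℍ) :
    (f ∣[k] ModularGroup.T) τ = f (ModularGroup.T • τ) := by
  rw [SL_slash_apply, ModularGroup.denom_apply]
  simp [ModularGroup.coe_T]

lemma coe_S_smul (τ : ℍ) : ((ModularGroup.S • τ : ℍ) : ℂ) = -1 / τ := by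
  rw [UpperHalfPlane.modular_S_smul]
  simp [neg_div, inv_neg]

lemma coe_T_smul (τ : ℍ) : ((ModularGroup.T • τ : ℍ) : ℂ) = τ + 1 := by
  rw [UpperHalfPlane.modular_T_smul]
  simp [add_comm]

lemma thX_slash_T : thX ∣[(2 : ℤ)] ModularGroup.T = -thX := by
  ext τ
  rw [slash_T_apply, thX, coe_T_smul, Theta2_add_one_pow]
  rfl

lemma thY_slash_T : thY ∣[(2 : ℤ)] ModularGroup.T = thW := by
  ext τ
  rw [slash_T_apply, thY, thW, coe_T_smul, Theta4_eq_jacobiTheta_add_one]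

lemma thW_slash_T : thW ∣[(2 : ℤ)] ModularGroup.T = thY := by
  ext τ
  rw [slash_T_apply, thY, thW, coe_T_smul, Theta4_eq_jacobiTheta_add_one, add_assoc,
    one_add_one_eq_two, jacobiTheta_add_two]

lemma neg_sq_mul_mul_zpow (τ : ℍ) (a : ℂ) : -(τ : ℂ) ^ 2 * a * (τ : ℂ) ^ (-2 : ℤ) = -a := by
  have := ne_zero τ
  field_simp

lemma thX_slash_S : thX ∣[(2 : ℤ)] ModularGroup.S = -thW := by
  ext τ
  rw [slash_S_apply, thX, coe_S_smul, Theta2_neg_inv_pow τ.im_pos, neg_sq_mul_mul_zpow]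
  rfl

lemma thY_slash_S : thY ∣[(2 : ℤ)] ModularGroup.S = -thY := by
  ext τ
  rw [slash_S_apply, thY, coe_S_smul, jacobiTheta_neg_inv_pow τ.im_pos, neg_sq_mul_mul_zpow]
  rfl

lemma thW_slash_S : thW ∣[(2 : ℤ)] ModularGroup.S = -thX := by
  ext τ
  rw [slash_S_apply, thW, coe_S_smul, Theta4_neg_inv_pow τ.im_pos, neg_sq_mul_mul_zpow]
  rfl

/-! ### Holomorphy of the theta functions and their leading terms at ∞. -/

lemma differentiableAt_Theta4 {z : ℂ} (hz : 0 < z.im) : DifferentiableAt ℂ Theta4 z :=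
  differentiableAt_jacobiTheta₂_snd _ hz

lemma differentiableAt_Theta2 {z : ℂ} (hz : 0 < z.im) : DifferentiableAt ℂ Theta2 z := by
  rw [funext Theta2_eq_jacobiTheta₂]
  refine DifferentiableAt.mul (by fun_prop) ?_
  exact (hasFDerivAt_jacobiTheta₂ (z / 2) hz).differentiableAt.comp z
    (f := fun w : ℂ ↦ (w / 2, w)) (by fun_prop)

lemma mdifferentiable_of_differentiableAt {f : ℍ → ℂ} (g : ℂ → ℂ) (hfg : ∀ τ : ℍ, f τ = g τ)
    (hg : ∀ z : ℂ, 0 < z.im → DifferentiableAt ℂ g z) : MDiff f := by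
  rw [UpperHalfPlane.mdifferentiable_iff]
  exact DifferentiableOn.congr (fun z hz ↦ (hg z hz).differentiableWithinAt)
    fun z hz ↦ by simp [ofComplex_apply_of_im_pos hz, hfg]

lemma thX_mdiff : MDiff thX :=
  mdifferentiable_of_differentiableAt (fun z ↦ Theta2 z ^ 4) (fun _ ↦ rfl)
    fun _ hz ↦ (differentiableAt_Theta2 hz).pow 4

lemma thY_mdiff : MDiff thY :=
  mdifferentiable_of_differentiableAt (fun z ↦ jacobiTheta z ^ 4) (fun _ ↦ rfl)
    fun _ hz ↦ (differentiableAt_jacobiTheta hz).pow 4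

lemma thW_mdiff : MDiff thW :=
  mdifferentiable_of_differentiableAt (fun z ↦ Theta4 z ^ 4) (fun _ ↦ rfl)
    fun _ hz ↦ (differentiableAt_Theta4 hz).pow 4

lemma norm_cexp_pi_I_mul (e : ℝ) (τ : ℂ) : ‖cexp (π * I * e * τ)‖ = rexp (-π * e * τ.im) := by
  rw [Complex.norm_exp]
  congr 1
  simp [mul_re, mul_im]

lemma tendsto_im_atImInfty : Tendsto (fun τ : ℍ ↦ τ.im) atImInfty atTop :=
  tendsto_comap

lemma tendsto_cexp_atImInfty {e : ℝ} (he : 0 < e) :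
    Tendsto (fun τ : ℍ ↦ cexp (π * I * e * τ)) atImInfty (𝓝 0) := by
  rw [tendsto_zero_iff_norm_tendsto_zero]
  simp_rw [norm_cexp_pi_I_mul]
  refine Real.tendsto_exp_atBot.comp ?_
  exact tendsto_im_atImInfty.const_mul_atTop_of_neg (by nlinarith [Real.pi_pos])

/-- Dominated convergence: for Im τ ≥ 1 each term is bounded by its absolute value at Im τ = 1, and
only the terms with exponent zero survive. -/
lemma tendsto_tsum_cexp_atImInfty {ι : Type*} [Countable ι] (e : ι → ℝ) (he : ∀ i, 0 ≤ e i)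
    (hs : Summable fun i ↦ rexp (-π * e i)) :
    Tendsto (fun τ : ℍ ↦ ∑' i, cexp (π * I * e i * τ)) atImInfty
      (𝓝 (∑' i, if e i = 0 then 1 else 0)) := by
  refine tendsto_tsum_of_dominated_convergence hs (fun i ↦ ?_) ?_
  · split_ifs with h
    · simp [h]
    · exact tendsto_cexp_atImInfty (lt_of_le_of_ne (he i) (Ne.symm h))
  · filter_upwards [tendsto_im_atImInfty.eventually_ge_atTop 1] with τ hτ i
    rw [norm_cexp_pi_I_mul]
    refine Real.exp_le_exp.mpr ?_
    have := mul_nonneg Real.pi_pos.le (he i)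
    rw [UpperHalfPlane.coe_im]
    nlinarith

lemma summable_exp_neg_pi_mul_of_le (e : ℤ → ℝ) (he : ∀ n : ℤ, (n.natAbs : ℝ) - 1 ≤ e n) :
    Summable fun i ↦ rexp (-π * e i) := by
  have h1 : Summable fun n : ℤ ↦ rexp π * rexp (-π) ^ n.natAbs := by
    refine Summable.mul_left _ (Summable.of_nat_of_neg ?_ ?_) <;>
    · simpa using summable_geometric_of_lt_one (Real.exp_pos (-π)).le
        (Real.exp_lt_one_iff.mpr (by linarith [Real.pi_pos]))
  refine h1.of_nonneg_of_le (fun _ ↦ (Real.exp_pos _).le) fun n ↦ ?_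
  rw [← Real.exp_nat_mul, ← Real.exp_add]
  refine Real.exp_le_exp.mpr ?_
  have := mul_le_mul_of_nonneg_left (he n) Real.pi_pos.le
  linarith

/-- The local parameter `exp(πiτ)` of `Γ(2)` at `∞`. -/
noncomputable def qh (τ : ℍ) : ℂ := cexp (π * I * τ)

lemma qh_ne_zero (τ : ℍ) : qh τ ≠ 0 := Complex.exp_ne_zero _

lemma tendsto_qh : Tendsto qh atImInfty (𝓝 0) := by
  simpa [qh] using! tendsto_cexp_atImInfty one_pos

lemma tendsto_thX_div_qh : Tendsto (fun τ ↦ thX τ / qh τ) atImInfty (𝓝 16) := by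
  have h : Tendsto (fun τ : ℍ ↦ ∑' n : ℤ, cexp (π * I * ((n * (n + 1) : ℤ) : ℝ) * τ)) atImInfty
      (𝓝 2) := by
    convert! tendsto_tsum_cexp_atImInfty (fun n : ℤ ↦ ((n * (n + 1) : ℤ) : ℝ)) ?_ ?_ using 2
    -- The exponent n(n+1) vanishes exactly at n = 0 and n = −1, so the limit is 2, and 2⁴ = 16.
    · rw [tsum_eq_sum (s := {0, -1})]
      · rw [Finset.sum_pair (by norm_num)]
        norm_num
      · intro n hn
        simp only [Finset.mem_insert, Finset.mem_singleton, not_or] at hn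
        rw [if_neg]
        norm_cast
        intro h
        rcases mul_eq_zero.mp h with h | h <;> omega
    · intro n
      have : 0 ≤ n * (n + 1) := by
        rcases le_or_gt 0 n with h | h
        · positivity
        · nlinarith
      exact_mod_cast this
    · refine summable_exp_neg_pi_mul_of_le _ fun n ↦ ?_
      have : (n.natAbs : ℤ) - 1 ≤ n * (n + 1) := by
        rcases le_or_gt 0 n with h | h
        · rw [Int.natAbs_of_nonneg h]; nlinarith
        · rw [Int.ofNat_natAbs_of_nonpos h.le]; nlinarith [sq_nonneg (n + 1)]
      exact_mod_cast this
  convert! h.pow 4 using 2 with τ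
  · rw [thX, Theta2, mul_pow, ← Complex.exp_nat_mul, qh,
      show ((4 : ℕ) : ℂ) * (2 * π * I * τ / 8) = π * I * τ by push_cast; ring,
      mul_div_cancel_left₀ _ (Complex.exp_ne_zero _)]
    congr 1
    refine tsum_congr fun n ↦ ?_
    congr 1
    push_cast
    ring
  · norm_num

lemma tendsto_jacobiTheta_sub_one_div_qh :
    Tendsto (fun τ : ℍ ↦ (jacobiTheta τ - 1) / qh τ) atImInfty (𝓝 2) := by
  -- The exponents are (n+1)² − 1 = n² + 2n, what remains after division by `qh`.
  have h : Tendsto (fun τ : ℍ ↦ ∑' n : ℕ, cexp (π * I * ((n ^ 2 + 2 * n : ℕ) : ℝ) * τ)) atImInfty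
      (𝓝 1) := by
    convert! tendsto_tsum_cexp_atImInfty (fun n : ℕ ↦ ((n ^ 2 + 2 * n : ℕ) : ℝ)) ?_ ?_ using 2
    · rw [tsum_eq_single 0]
      · norm_num
      · intro n hn
        rw [if_neg]
        norm_cast
        positivity
    · intro n
      positivity
    · have h1 := summable_geometric_of_lt_one (Real.exp_pos (-π)).le
        (Real.exp_lt_one_iff.mpr (by linarith [Real.pi_pos]))
      refine h1.of_nonneg_of_le (fun _ ↦ (Real.exp_pos _).le) fun n ↦ ?_
      rw [← Real.exp_nat_mul]
      refine Real.exp_le_exp.mpr ?_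
      have : (n : ℝ) ≤ ((n ^ 2 + 2 * n : ℕ) : ℝ) := by exact_mod_cast (by nlinarith)
      nlinarith [Real.pi_pos]
  convert! h.const_mul 2 using 2 with τ
  · have h2 := (hasSum_nat_jacobiTheta τ.im_pos).tsum_eq
    have h3 : jacobiTheta τ - 1 = 2 * ∑' n : ℕ, cexp (π * I * ((n : ℂ) + 1) ^ 2 * τ) := by
      rw [h2]; ring
    rw [h3, div_eq_iff (qh_ne_zero τ), mul_assoc, ← tsum_mul_right]
    congr 1
    refine tsum_congr fun n ↦ ?_
    rw [qh, ← Complex.exp_add]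
    congr 1
    push_cast
    ring
  · norm_num

lemma tendsto_jacobiTheta : Tendsto (fun τ : ℍ ↦ jacobiTheta τ) atImInfty (𝓝 1) := by
  have := (tendsto_jacobiTheta_sub_one_div_qh.mul tendsto_qh).add_const 1
  simpa [div_mul_cancel₀ _ (qh_ne_zero _)] using this

lemma tendsto_thX : Tendsto thX atImInfty (𝓝 0) := by
  have := tendsto_thX_div_qh.mul tendsto_qh
  simpa [div_mul_cancel₀ _ (qh_ne_zero _)] using this

lemma tendsto_thY : Tendsto thY atImInfty (𝓝 1) := by
  simpa using! tendsto_jacobiTheta.pow 4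

lemma tendsto_T_smul : Tendsto (fun τ : ℍ ↦ ModularGroup.T • τ) atImInfty atImInfty := by
  refine tendsto_comap_iff.mpr ?_
  convert tendsto_im_atImInfty using 1
  ext τ
  have := congrArg Complex.im (coe_T_smul τ)
  simpa using this

lemma tendsto_thW : Tendsto thW atImInfty (𝓝 1) := by
  have h : thW = fun τ ↦ thY (ModularGroup.T • τ) := by
    ext τ
    rw [← thY_slash_T, slash_T_apply]
  rw [h]
  exact tendsto_thY.comp tendsto_T_smul

lemma tendsto_thY_sub_one_div_qh : Tendsto (fun τ ↦ (thY τ - 1) / qh τ) atImInfty (𝓝 8) := by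
  have h := tendsto_jacobiTheta_sub_one_div_qh.mul
    (((tendsto_jacobiTheta.pow 3).add (tendsto_jacobiTheta.pow 2)).add
      (tendsto_jacobiTheta.add_const 1))
  convert! h using 2 with τ
  · rw [thY]; ring
  · norm_num

/-! ### Modular forms for Γ(2) and their three cusps. -/

lemma isBoundedAtImInfty_of_tendsto {f : ℍ → ℂ} {c : ℂ} (h : Tendsto f atImInfty (𝓝 c)) :
    IsBoundedAtImInfty f :=
  h.isBigO_one ℝ

lemma isBoundedAtImInfty_slash_T {f : ℍ → ℂ} (k : ℤ) (h : IsBoundedAtImInfty f) :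
    IsBoundedAtImInfty (f ∣[k] ModularGroup.T) := by
  have : f ∣[k] ModularGroup.T = fun τ ↦ f (ModularGroup.T • τ) := by
    ext τ; exact slash_T_apply k f τ
  rw [this]
  exact h.comp_tendsto tendsto_T_smul

/-- SL(2, ℤ/2) has six elements. The factor T is kept on the right because slashing by T preserves
boundedness at ∞, so boundedness has to be tested only for 1, S and TS, one for each cusp. -/
lemma exists_Gamma_two_mul (γ : SL(2, ℤ)) :
    ∃ g ∈ CongruenceSubgroup.Gamma 2, ∃ r : SL(2, ℤ), (r = 1 ∨ r = ModularGroup.S ∨ r = ModularGroup.T * ModularGroup.S) ∧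
      (γ = g * r ∨ γ = g * r * ModularGroup.T) := by
  have key : ∀ M : SL(2, ZMod 2), ∀ s t : SL(2, ZMod 2),
      s.1 = !![0, 1; 1, 0] → t.1 = !![1, 1; 0, 1] →
      M = 1 ∨ M = s ∨ M = t * s ∨ M = t ∨ M = s * t ∨ M = t * s * t := by
    intro M s t hs ht
    have hdet := M.det_coe
    have hi : ∀ A B : SL(2, ZMod 2), A = B ↔ A.1 = B.1 := fun _ _ ↦ Subtype.ext_iff
    rw [hi, hi, hi, hi, hi, hi]
    simp only [Matrix.SpecialLinearGroup.coe_mul, Matrix.SpecialLinearGroup.coe_one, hs, ht]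
    generalize M.1 = N at hdet ⊢
    revert N
    decide
  have hS : (Matrix.SpecialLinearGroup.map (Int.castRingHom (ZMod 2)) ModularGroup.S).1 = !![0, 1; 1, 0] := by
    rw [Matrix.SpecialLinearGroup.map_apply_coe, ModularGroup.coe_S]
    decide
  have hT : (Matrix.SpecialLinearGroup.map (Int.castRingHom (ZMod 2)) ModularGroup.T).1 = !![1, 1; 0, 1] := by
    rw [Matrix.SpecialLinearGroup.map_apply_coe, ModularGroup.coe_T]
    decide
  have main : ∀ r : SL(2, ℤ), Matrix.SpecialLinearGroup.map (Int.castRingHom (ZMod 2)) γ =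
      Matrix.SpecialLinearGroup.map (Int.castRingHom (ZMod 2)) r →
      γ * r⁻¹ ∈ CongruenceSubgroup.Gamma 2 := by
    intro r hr
    rw [CongruenceSubgroup.Gamma, MonoidHom.mem_ker, map_mul, map_inv, hr, mul_inv_cancel]
  rcases key (Matrix.SpecialLinearGroup.map (Int.castRingHom (ZMod 2)) γ) _ _ hS hT with
    h | h | h | h | h | h
  · exact ⟨γ * 1⁻¹, main 1 (by simpa using h), 1, by simp, .inl (by group)⟩
  · exact ⟨γ * ModularGroup.S⁻¹, main _ h, _, .inr (.inl rfl), .inl (by group)⟩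
  · exact ⟨γ * (ModularGroup.T * ModularGroup.S)⁻¹, main _ (by simpa using h), _,
      .inr (.inr rfl), .inl (by group)⟩
  · exact ⟨γ * ModularGroup.T⁻¹, main _ h, 1, .inl rfl, .inr (by group)⟩
  · exact ⟨γ * (ModularGroup.S * ModularGroup.T)⁻¹, main _ (by simpa using h), _,
      .inr (.inl rfl), .inr (by group)⟩
  · exact ⟨γ * (ModularGroup.T * ModularGroup.S * ModularGroup.T)⁻¹,
      main _ (by simpa using h), _, .inr (.inr rfl), .inr (by group)⟩

/-- Holomorphic functions on `ℍ` that are modular of weight `k` for `Γ(2)` and bounded at the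
three cusps `∞`, `0`, `1`. -/
structure IsMF (k : ℤ) (f : ℍ → ℂ) : Prop where
  mdiff : MDiff f
  slash_eq : ∀ γ ∈ CongruenceSubgroup.Gamma 2, f ∣[k] γ = f
  bdd_infty : IsBoundedAtImInfty f
  bdd_zero : IsBoundedAtImInfty (f ∣[k] ModularGroup.S)
  bdd_one : IsBoundedAtImInfty (f ∣[k] (ModularGroup.T * ModularGroup.S))

lemma IsMF.bdd {k : ℤ} {f : ℍ → ℂ} (h : IsMF k f) (γ : SL(2, ℤ)) :
    IsBoundedAtImInfty (f ∣[k] γ) := by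
  obtain ⟨g, hg, r, hr, hγ⟩ := exists_Gamma_two_mul γ
  have hb : IsBoundedAtImInfty (f ∣[k] r) := by
    rcases hr with rfl | rfl | rfl
    · simpa using h.bdd_infty
    · exact h.bdd_zero
    · exact h.bdd_one
  rcases hγ with rfl | rfl
  · rwa [SlashAction.slash_mul, h.slash_eq g hg]
  · rw [SlashAction.slash_mul, SlashAction.slash_mul, h.slash_eq g hg]
    exact isBoundedAtImInfty_slash_T k hb

/-- The bundled modular form. -/
noncomputable def IsMF.toModularForm {k : ℤ} {f : ℍ → ℂ} (h : IsMF k f) :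
    ModularForm (CongruenceSubgroup.Gamma 2) k where
  toFun := f
  slash_action_eq' A hA := by
    obtain ⟨A, hA', rfl⟩ := hA
    exact h.slash_eq A hA'
  holo' := h.mdiff
  bdd_at_cusps' {c} hc := by
    rw [Subgroup.IsArithmetic.isCusp_iff_isCusp_SL2Z] at hc
    rw [OnePoint.isBoundedAt_iff_forall_SL2Z hc]
    exact fun γ _ ↦ h.bdd γ

lemma isMF_of_modularForm {k : ℤ} (f : ModularForm (CongruenceSubgroup.Gamma 2) k) :
    IsMF k f := by
  have hb : ∀ γ : SL(2, ℤ), IsBoundedAtImInfty (f ∣[k] γ) := by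
    intro γ
    have hc : IsCusp (Matrix.SpecialLinearGroup.mapGL ℝ γ • OnePoint.infty)
        (CongruenceSubgroup.Gamma 2 : Subgroup (GL (Fin 2) ℝ)) := by
      rw [Subgroup.IsArithmetic.isCusp_iff_isCusp_SL2Z]
      exact isCusp_SL2Z_iff'.mpr ⟨γ, rfl⟩
    exact f.bdd_at_cusps' hc _ rfl
  refine ⟨f.holo', fun γ hγ ↦ ?_, by simpa using hb 1, hb _, hb _⟩
  exact f.slash_action_eq' _ ⟨γ, hγ, rfl⟩

lemma IsMF.eq_zero_of_neg {k : ℤ} (hk : k < 0) {f : ℍ → ℂ} (h : IsMF k f) : f = 0 := by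
  have := ModularForm.isZero_of_neg_weight hk h.toModularForm
  exact congrArg (fun F : ModularForm _ k ↦ (F : ℍ → ℂ)) this

lemma IsMF.eq_const {f : ℍ → ℂ} (h : IsMF 0 f) : ∃ c, ∀ τ, f τ = c := by
  obtain ⟨c, hc⟩ := ModularForm.eq_const_of_weight_zero h.toModularForm
  exact ⟨c, fun τ ↦ congrFun hc τ⟩

lemma slash_sub (k : ℤ) (γ : SL(2, ℤ)) (f g : ℍ → ℂ) :
    (f - g) ∣[k] γ = f ∣[k] γ - g ∣[k] γ := by
  rw [sub_eq_add_neg, SlashAction.add_slash, SlashAction.neg_slash, ← sub_eq_add_neg]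

/-! ### Consequences of level one: Jacobi's identity and zero-freeness. -/

section LevelOne

/-- A level one cusp form from a function that is invariant under the two generators. -/
noncomputable def cuspFormOfGenerators {k : ℤ} {f : ℍ → ℂ} (hd : MDiff f)
    (hS : f ∣[k] ModularGroup.S = f) (hT : f ∣[k] ModularGroup.T = f)
    (h0 : Tendsto f atImInfty (𝓝 0)) : CuspForm 𝒮ℒ k where
  toFun := f
  slash_action_eq' A hA := by
    obtain ⟨A, rfl⟩ := hA
    exact SlashInvariantForm.slash_action_generators_SL2Z hS hT A
  holo' := hd
  zero_at_cusps' {c} hc := by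
    rw [OnePoint.isZeroAt_iff_forall_SL2Z hc]
    intro γ _
    rw [SlashInvariantForm.slash_action_generators_SL2Z hS hT γ]
    exact h0

lemma eq_zero_of_weight_lt_twelve {k : ℤ} (hk : k < 12) {f : ℍ → ℂ} (hd : MDiff f)
    (hS : f ∣[k] ModularGroup.S = f) (hT : f ∣[k] ModularGroup.T = f)
    (h0 : Tendsto f atImInfty (𝓝 0)) : f = 0 := by
  have := rank_zero_iff_forall_zero.mp (CuspForm.rank_eq_zero_of_weight_lt_twelve hk)
    (cuspFormOfGenerators hd hS hT h0)
  exact congrArg (fun F : CuspForm 𝒮ℒ k ↦ (F : ℍ → ℂ)) this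

/-- A form of weight `6` for the sign character that vanishes at the cusp has no zeros on `ℍ`,
because its square is a multiple of the discriminant. -/
lemma ne_zero_of_slash_eq_neg {f : ℍ → ℂ} (hd : MDiff f)
    (hS : f ∣[(6 : ℤ)] ModularGroup.S = -f) (hT : f ∣[(6 : ℤ)] ModularGroup.T = -f)
    (h0 : Tendsto f atImInfty (𝓝 0)) (hne : f ≠ 0) (τ : ℍ) : f τ ≠ 0 := by
  have hsq : ∀ γ : SL(2, ℤ), f ∣[(6 : ℤ)] γ = -f → (f * f) ∣[(12 : ℤ)] γ = f * f := by
    intro γ hγ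
    have := mul_slash_SL2 6 6 γ f f
    rw [hγ, neg_mul_neg] at this
    exact this
  obtain ⟨c, hc⟩ := CuspForm.exists_smul_discriminant_of_weight_eq_twelve
    (cuspFormOfGenerators (hd.mul hd) (hsq _ hS) (hsq _ hT) (by simpa using! h0.mul h0))
  have hc' : ∀ τ, c * ModularForm.discriminant τ = f τ * f τ := fun τ ↦
    congrArg (fun F : CuspForm 𝒮ℒ 12 ↦ F τ) hc
  have hc0 : c ≠ 0 := by
    rintro rfl
    exact hne (funext fun τ ↦ by simpa using (hc' τ).symm)
  have := mul_ne_zero hc0 (discriminant_ne_zero τ)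
  rw [hc' τ] at this
  exact left_ne_zero_of_mul this

end LevelOne

/-- Jacobi's identity `Θ₂⁴ + Θ₄⁴ = Θ₃⁴`. -/
lemma thX_add_thW : thX + thW = thY := by
  have hd : MDiff (thX + thW - thY) := (thX_mdiff.add thW_mdiff).sub thY_mdiff
  have hS : (thX + thW - thY) ∣[(2 : ℤ)] ModularGroup.S = -(thX + thW - thY) := by
    rw [slash_sub, SlashAction.add_slash, thX_slash_S, thY_slash_S, thW_slash_S]
    ring
  have hT : (thX + thW - thY) ∣[(2 : ℤ)] ModularGroup.T = -(thX + thW - thY) := by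
    rw [slash_sub, SlashAction.add_slash, thX_slash_T, thY_slash_T, thW_slash_T]
    ring
  have h0 : Tendsto (thX + thW - thY) atImInfty (𝓝 0) := by
    simpa using! (tendsto_thX.add tendsto_thW).sub tendsto_thY
  -- Both generators negate the difference, so its square is a level one cusp form of weight 4 and
  -- therefore zero.
  have hsq : ∀ γ : SL(2, ℤ), (thX + thW - thY) ∣[(2 : ℤ)] γ = -(thX + thW - thY) →
      ((thX + thW - thY) * (thX + thW - thY)) ∣[(2 + 2 : ℤ)] γ =
        (thX + thW - thY) * (thX + thW - thY) := by
    intro γ hγ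
    rw [mul_slash_SL2, hγ, neg_mul_neg]
  have := eq_zero_of_weight_lt_twelve (by norm_num) (hd.mul hd) (hsq _ hS) (hsq _ hT)
    (by simpa using! h0.mul h0)
  ext τ
  exact sub_eq_zero.mp (mul_self_eq_zero.mp (congrFun this τ))

lemma thW_eq : thW = thY - thX := by rw [← thX_add_thW]; ring

/-- The product has weight 6, changes sign under S and T, and has leading term 16 `qh`, so it is a
nonzero form for the sign character. -/
lemma thX_mul_thY_mul_thW_ne_zero (τ : ℍ) : thX τ * (thY τ * thW τ) ≠ 0 := by
  have hlim := tendsto_thX_div_qh.mul (tendsto_thY.mul tendsto_thW)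
  refine ne_zero_of_slash_eq_neg (f := thX * (thY * thW))
    (thX_mdiff.mul (thY_mdiff.mul thW_mdiff)) ?_ ?_ ?_ ?_ τ
  · have := mul_slash_SL2 2 (2 + 2) ModularGroup.S thX (thY * thW)
    rw [mul_slash_SL2 2 2, thX_slash_S, thY_slash_S, thW_slash_S] at this
    rw [show (6 : ℤ) = 2 + (2 + 2) by norm_num, this]
    ring
  · have := mul_slash_SL2 2 (2 + 2) ModularGroup.T thX (thY * thW)
    rw [mul_slash_SL2 2 2, thX_slash_T, thY_slash_T, thW_slash_T] at this
    rw [show (6 : ℤ) = 2 + (2 + 2) by norm_num, this]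
    ring
  · simpa using! tendsto_thX.mul (tendsto_thY.mul tendsto_thW)
  · intro h
    have hz : (fun τ ↦ thX τ / qh τ * (thY τ * thW τ)) = fun _ ↦ 0 := by
      ext τ
      have := congrFun h τ
      simp only [Pi.mul_apply, Pi.zero_apply] at this
      rw [div_mul_eq_mul_div, this, zero_div]
    rw [hz] at hlim
    have := tendsto_nhds_unique hlim tendsto_const_nhds
    norm_num at this

lemma thX_ne_zero (τ : ℍ) : thX τ ≠ 0 := left_ne_zero_of_mul (thX_mul_thY_mul_thW_ne_zero τ)

lemma thY_ne_zero (τ : ℍ) : thY τ ≠ 0 :=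
  left_ne_zero_of_mul (right_ne_zero_of_mul (thX_mul_thY_mul_thW_ne_zero τ))

lemma lam_ne_zero (τ : ℍ) : lam τ ≠ 0 := div_ne_zero (thX_ne_zero τ) (thY_ne_zero τ)

lemma one_sub_lam (τ : ℍ) : 1 - lam τ = thW τ / thY τ := by
  have h := thY_ne_zero τ
  rw [lam_eq_thX_div_thY, thW_eq, Pi.sub_apply]
  field_simp

lemma tendsto_lam_div_qh : Tendsto (fun τ : ℍ ↦ lam τ / qh τ) atImInfty (𝓝 16) := by
  have := tendsto_thX_div_qh.div tendsto_thY one_ne_zero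
  rw [div_one] at this
  refine this.congr fun τ ↦ ?_
  rw [Pi.div_apply, lam_eq_thX_div_thY]
  ring

lemma tendsto_lam : Tendsto (fun τ : ℍ ↦ lam τ) atImInfty (𝓝 0) := by
  simpa using! tendsto_thX.div tendsto_thY one_ne_zero

/-! ### Families permuted by SL(2, ℤ) like the nonzero vectors modulo 2. -/

section Permutation

/-- The right action of `SL(2, ℤ)` on row vectors modulo `2`. -/
def vecAct (a : Fin 2 → ZMod 2) (γ : SL(2, ℤ)) : Fin 2 → ZMod 2 :=
  Matrix.vecMul a (Matrix.SpecialLinearGroup.map (Int.castRingHom (ZMod 2)) γ).1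

lemma vecAct_mul (a : Fin 2 → ZMod 2) (γ δ : SL(2, ℤ)) :
    vecAct a (γ * δ) = vecAct (vecAct a γ) δ := by
  unfold vecAct
  rw [Matrix.vecMul_vecMul, map_mul, Matrix.SpecialLinearGroup.coe_mul]

lemma vecAct_one (a : Fin 2 → ZMod 2) : vecAct a 1 = a := by
  simp [vecAct]

lemma vecAct_zero (γ : SL(2, ℤ)) : vecAct 0 γ = 0 := by
  simp [vecAct]

lemma vecAct_ne_zero {a : Fin 2 → ZMod 2} (ha : a ≠ 0) (γ : SL(2, ℤ)) : vecAct a γ ≠ 0 := by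
  intro h
  apply ha
  rw [← vecAct_one a, ← mul_inv_cancel γ, vecAct_mul, h, vecAct_zero]

lemma vecAct_of_mem_Gamma (a : Fin 2 → ZMod 2) {γ : SL(2, ℤ)}
    (hγ : γ ∈ CongruenceSubgroup.Gamma 2) : vecAct a γ = a := by
  rw [CongruenceSubgroup.Gamma, MonoidHom.mem_ker] at hγ
  simp [vecAct, hγ]

lemma vecAct_S (a : Fin 2 → ZMod 2) : vecAct a ModularGroup.S = ![a 1, a 0] := by
  have h : (Matrix.SpecialLinearGroup.map (Int.castRingHom (ZMod 2)) ModularGroup.S).1 =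
      !![0, 1; 1, 0] := by
    rw [Matrix.SpecialLinearGroup.map_apply_coe, ModularGroup.coe_S]
    decide
  rw [vecAct, h]
  ext i; fin_cases i <;> simp [Matrix.vecMul, dotProduct]

lemma vecAct_T (a : Fin 2 → ZMod 2) : vecAct a ModularGroup.T = ![a 0, a 0 + a 1] := by
  have h : (Matrix.SpecialLinearGroup.map (Int.castRingHom (ZMod 2)) ModularGroup.T).1 =
      !![1, 1; 0, 1] := by
    rw [Matrix.SpecialLinearGroup.map_apply_coe, ModularGroup.coe_T]
    decide
  rw [vecAct, h]
  ext i; fin_cases i <;> simp [Matrix.vecMul, dotProduct]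

lemma zmod_two_vec_cases : ∀ a : Fin 2 → ZMod 2, a ≠ 0 → a = ![0, 1] ∨ a = ![1, 0] ∨ a = ![1, 1] := by
  decide

variable {V : (Fin 2 → ZMod 2) → ℍ → ℂ} {k : ℤ} {cS cT : ℍ → ℂ}

/-- The defects `cS` and `cT` do not depend on the vector, so they cancel in differences. This
handles the quasimodular G₂, and makes Γ(2)-invariance follow from the two generators of SL(2, ℤ)
alone. -/
lemma sub_slash_eq_of_generators
    (hS : ∀ a, a ≠ 0 → V a ∣[k] ModularGroup.S = V (vecAct a ModularGroup.S) + cS)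
    (hT : ∀ a, a ≠ 0 → V a ∣[k] ModularGroup.T = V (vecAct a ModularGroup.T) + cT)
    (γ : SL(2, ℤ)) {a b : Fin 2 → ZMod 2} (ha : a ≠ 0) (hb : b ≠ 0) :
    (V a - V b) ∣[k] γ = V (vecAct a γ) - V (vecAct b γ) := by
  have hγ : γ ∈ Subgroup.closure {ModularGroup.S, ModularGroup.T} := by
    rw [SpecialLinearGroup.SL2Z_generators]; trivial
  induction hγ using Subgroup.closure_induction generalizing a b with
  | mem x hx =>
    rcases hx with rfl | rfl
    · rw [slash_sub, hS a ha, hS b hb]; ring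
    · rw [slash_sub, hT a ha, hT b hb]; ring
  | one => simp [vecAct_one]
  | mul x y _ _ hx hy =>
    rw [SlashAction.slash_mul, hx ha hb, hy (vecAct_ne_zero ha x) (vecAct_ne_zero hb x),
      vecAct_mul, vecAct_mul]
  | inv x _ hx =>
    have := hx (vecAct_ne_zero ha x⁻¹) (vecAct_ne_zero hb x⁻¹)
    rw [← vecAct_mul, ← vecAct_mul, inv_mul_cancel, vecAct_one, vecAct_one] at this
    rw [← this, ← SlashAction.slash_mul, mul_inv_cancel, SlashAction.slash_one]

lemma isMF_sub_of_generators
    (hS : ∀ a, a ≠ 0 → V a ∣[k] ModularGroup.S = V (vecAct a ModularGroup.S) + cS)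
    (hT : ∀ a, a ≠ 0 → V a ∣[k] ModularGroup.T = V (vecAct a ModularGroup.T) + cT)
    (hd : ∀ a, a ≠ 0 → MDiff (V a)) (hbd : ∀ a, a ≠ 0 → IsBoundedAtImInfty (V a))
    {a b : Fin 2 → ZMod 2} (ha : a ≠ 0) (hb : b ≠ 0) : IsMF k (V a - V b) := by
  have key := fun γ ↦ sub_slash_eq_of_generators hS hT γ ha hb
  have hbdd : ∀ γ, IsBoundedAtImInfty ((V a - V b) ∣[k] γ) := fun γ ↦ by
    rw [key]
    exact (hbd _ (vecAct_ne_zero ha γ)).sub (hbd _ (vecAct_ne_zero hb γ))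
  refine ⟨(hd a ha).sub (hd b hb), fun γ hγ ↦ ?_, by simpa using hbdd 1, hbdd _, hbdd _⟩
  rw [key, vecAct_of_mem_Gamma a hγ, vecAct_of_mem_Gamma b hγ]

end Permutation

/-! ### Closure properties of modular forms for Γ(2). -/

section Algebra

variable {k l : ℤ} {f g : ℍ → ℂ}

lemma IsMF.smul (c : ℂ) (hf : IsMF k f) : IsMF k (c • f) where
  mdiff := hf.mdiff.const_smul c
  slash_eq γ hγ := by rw [SL_smul_slash, hf.slash_eq γ hγ]
  bdd_infty := hf.bdd_infty.const_mul_left c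
  bdd_zero := by
    rw [SL_smul_slash]; exact hf.bdd_zero.const_mul_left c
  bdd_one := by
    rw [SL_smul_slash]; exact hf.bdd_one.const_mul_left c

lemma IsMF.sub (hf : IsMF k f) (hg : IsMF k g) : IsMF k (f - g) where
  mdiff := hf.mdiff.sub hg.mdiff
  slash_eq γ hγ := by rw [slash_sub, hf.slash_eq γ hγ, hg.slash_eq γ hγ]
  bdd_infty := hf.bdd_infty.sub hg.bdd_infty
  bdd_zero := by rw [slash_sub]; exact hf.bdd_zero.sub hg.bdd_zero
  bdd_one := by rw [slash_sub]; exact hf.bdd_one.sub hg.bdd_one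

lemma IsMF.mul (hf : IsMF k f) (hg : IsMF l g) : IsMF (k + l) (f * g) where
  mdiff := hf.mdiff.mul hg.mdiff
  slash_eq γ hγ := by rw [mul_slash_SL2, hf.slash_eq γ hγ, hg.slash_eq γ hγ]
  bdd_infty := hf.bdd_infty.mul hg.bdd_infty
  bdd_zero := by rw [mul_slash_SL2]; exact hf.bdd_zero.mul hg.bdd_zero
  bdd_one := by rw [mul_slash_SL2]; exact hf.bdd_one.mul hg.bdd_one

lemma isMF_one : IsMF 0 (1 : ℍ → ℂ) := by
  have hb : IsBoundedAtImInfty (1 : ℍ → ℂ) := const_boundedAtFilter _ _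
  refine ⟨mdifferentiable_const, fun γ _ ↦ is_invariant_one γ, hb, ?_, ?_⟩ <;>
  · rw [is_invariant_one]; exact hb

lemma IsMF.pow (hf : IsMF k f) (n : ℕ) : IsMF (n * k) (f ^ n) := by
  induction n with
  | zero => simpa using isMF_one
  | succ n ih =>
    rw [pow_succ]
    convert! ih.mul hf using 1
    push_cast; ring

end Algebra

/-! ### Modularity of Θ₂⁴ and Θ₃⁴. -/

section Theta

/-- The combinations of `Θ₂⁴`, `Θ₃⁴`, `Θ₄⁴` that `SL(2, ℤ)` permutes without signs. -/
noncomputable def thV (a : Fin 2 → ZMod 2) : ℍ → ℂ :=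
  if a = ![0, 1] then -thY - thW else if a = ![1, 0] then thX + thY else thW - thX

/-- By Jacobi's identity the differences of the three combinations are ±3Θ₂⁴, ±3Θ₃⁴, ±3Θ₄⁴, which
makes the fourth powers themselves forms for Γ(2). -/
lemma thV_isMF {a b : Fin 2 → ZMod 2} (ha : a ≠ 0) (hb : b ≠ 0) : IsMF 2 (thV a - thV b) := by
  have e1 : thV ![0, 1] = -thY - thW := by simp [thV]
  have e2 : thV ![1, 0] = thX + thY := by simp [thV]
  have e3 : thV ![1, 1] = thW - thX := by simp [thV]
  refine isMF_sub_of_generators (cS := 0) (cT := 0) ?_ ?_ ?_ ?_ ha hb <;> intro a ha <;>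
    rcases zmod_two_vec_cases a ha with rfl | rfl | rfl
  · rw [vecAct_S]
    simp only [Matrix.cons_val_zero, Matrix.cons_val_one, e1, e2, slash_sub,
      SlashAction.neg_slash, thY_slash_S, thW_slash_S]
    ring
  · rw [vecAct_S]
    simp only [Matrix.cons_val_zero, Matrix.cons_val_one, e1, e2, SlashAction.add_slash,
      thX_slash_S, thY_slash_S]
    ring
  · rw [vecAct_S]
    simp only [Matrix.cons_val_zero, Matrix.cons_val_one, e3, slash_sub,
      thX_slash_S, thW_slash_S]
    ring
  · rw [vecAct_T]
    simp only [Matrix.cons_val_zero, Matrix.cons_val_one, zero_add, e1, slash_sub,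
      SlashAction.neg_slash, thY_slash_T, thW_slash_T]
    ring
  · rw [vecAct_T]
    simp only [Matrix.cons_val_zero, Matrix.cons_val_one, add_zero, e2, e3,
      SlashAction.add_slash, thX_slash_T, thY_slash_T]
    ring
  · rw [vecAct_T]
    simp only [Matrix.cons_val_zero, Matrix.cons_val_one, show (1 + 1 : ZMod 2) = 0 from rfl, e2,
      e3, slash_sub, thX_slash_T, thW_slash_T]
    ring
  · rw [e1]; exact thY_mdiff.neg.sub thW_mdiff
  · rw [e2]; exact thX_mdiff.add thY_mdiff
  · rw [e3]; exact thW_mdiff.sub thX_mdiff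
  · rw [e1]; exact isBoundedAtImInfty_of_tendsto (tendsto_thY.neg.sub tendsto_thW)
  · rw [e2]; exact isBoundedAtImInfty_of_tendsto (tendsto_thX.add tendsto_thY)
  · rw [e3]; exact isBoundedAtImInfty_of_tendsto (tendsto_thW.sub tendsto_thX)

lemma thX_isMF : IsMF 2 thX := by
  convert! (thV_isMF (a := ![1, 0]) (b := ![1, 1]) (by decide) (by decide)).smul (1 / 3) using 1
  ext τ
  simp [thV, thW_eq]
  ring

lemma thY_isMF : IsMF 2 thY := by
  convert! (thV_isMF (a := ![1, 0]) (b := ![0, 1]) (by decide) (by decide)).smul (1 / 3) using 1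
  ext τ
  simp [thV, thW_eq]
  ring

end Theta

/-! ### The derivative of λ has no zeros. -/

section Derivative

open Derivative

/-- Cauchy's estimate for f − c on the disc of radius 1 about τ. -/
lemma tendsto_normalizedDeriv {f : ℍ → ℂ} (hd : MDiff f) {c : ℂ}
    (h : Tendsto f atImInfty (𝓝 c)) :
    Tendsto (normalizedDerivOfComplex f) atImInfty (𝓝 0) := by
  rw [show (0 : ℂ) = (2 * π * I)⁻¹ * 0 by simp]
  refine Tendsto.const_mul _ ?_
  rw [Metric.tendsto_nhds]
  intro ε hε
  have h1 := (Metric.tendsto_nhds.mp h) (ε / 2) (half_pos hε)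
  obtain ⟨A, hA⟩ := (atImInfty_mem _).mp h1
  filter_upwards [tendsto_im_atImInfty.eventually_ge_atTop (max A 0 + 2)] with τ hτ
  have hdiff := UpperHalfPlane.mdifferentiable_iff.mp hd
  have hball : ∀ z ∈ Metric.closedBall (τ : ℂ) 1, max A 0 < z.im := by
    intro z hz
    have := (abs_im_le_norm (z - τ)).trans (mem_closedBall_iff_norm.mp hz)
    rw [sub_im, UpperHalfPlane.coe_im, abs_le] at this
    linarith [this.1]
  have hpos : ∀ z ∈ Metric.closedBall (τ : ℂ) 1, 0 < z.im := fun z hz ↦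
    (le_max_right A 0).trans_lt (hball z hz)
  have hD : DifferentiableOn ℂ (fun z ↦ (f ∘ ofComplex) z - c) (Metric.closedBall (τ : ℂ) 1) :=
    (hdiff.mono fun z hz ↦ hpos z hz).sub_const c
  have := norm_deriv_le_of_forall_mem_sphere_norm_le (c := (τ : ℂ)) (C := ε / 2) one_pos
    (hD.mono (by rw [closure_ball _ one_ne_zero])).diffContOnCl (fun z hz ↦ by
      have hz' := Metric.sphere_subset_closedBall hz
      have := hA ⟨z, hpos z hz'⟩ ((le_max_left A 0).trans (hball z hz').le)
      rw [← dist_eq_norm, Function.comp_apply, ofComplex_apply_of_im_pos (hpos z hz')]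
      exact le_of_lt this)
  rw [deriv_sub_const, div_one] at this
  rw [dist_zero_right]
  linarith

/-- The Wronskian of `Θ₂⁴` and `Θ₃⁴`. -/
noncomputable def thWr : ℍ → ℂ :=
  serreDerivative ((2 : ℤ) : ℂ) thX * thY - thX * serreDerivative ((2 : ℤ) : ℂ) thY

/-- Both functions have weight 2, so the E₂ terms of the Serre derivatives cancel. -/
lemma thWr_apply (τ : ℍ) : thWr τ = normalizedDerivOfComplex thX τ * thY τ -
    thX τ * normalizedDerivOfComplex thY τ := by
  simp only [thWr, Pi.sub_apply, Pi.mul_apply, serreDerivative_apply]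
  ring

lemma hasDerivAt_of_eq {f : ℍ → ℂ} {g : ℂ → ℂ} (hfg : ∀ τ : ℍ, f τ = g τ) (hd : MDiff f)
    (τ : ℍ) : HasDerivAt g (2 * π * I * normalizedDerivOfComplex f τ) τ := by
  have h1 := (UpperHalfPlane.mdifferentiableAt_iff.mp (hd τ)).hasDerivAt
  have h2 : (2 * π * I * normalizedDerivOfComplex f τ) = deriv (f ∘ ofComplex) τ := by
    rw [normalizedDerivOfComplex, mul_inv_cancel_left₀ two_pi_I_ne_zero]
  rw [h2]
  refine h1.congr_of_eventuallyEq ?_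
  filter_upwards [isOpen_upperHalfPlaneSet.mem_nhds τ.im_pos] with z hz
  rw [Function.comp_apply, ofComplex_apply_of_im_pos hz, hfg]

lemma hasDerivAt_lam (τ : ℍ) : HasDerivAt lam (2 * π * I * thWr τ / thY τ ^ 2) τ := by
  have hX := hasDerivAt_of_eq (g := fun z ↦ Theta2 z ^ 4) (fun _ ↦ rfl) thX_mdiff τ
  have hY := hasDerivAt_of_eq (g := fun z ↦ jacobiTheta z ^ 4) (fun _ ↦ rfl) thY_mdiff τ
  refine (hX.div hY (thY_ne_zero τ)).congr_deriv ?_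
  change (2 * π * I * normalizedDerivOfComplex thX τ * thY τ -
    thX τ * (2 * π * I * normalizedDerivOfComplex thY τ)) / thY τ ^ 2 = _
  rw [thWr_apply]
  ring

/-- The Wronskian has weight 6, takes the sign −1 under S and T, and tends to 0 at ∞. It is not
identically zero, since otherwise λ would be constant, whereas λ tends to 0 without taking that
value. -/
lemma thWr_ne_zero (τ : ℍ) : thWr τ ≠ 0 := by
  have e : ∀ γ : SL(2, ℤ), thWr ∣[(6 : ℤ)] γ =
      serreDerivative ((2 : ℤ) : ℂ) (thX ∣[(2 : ℤ)] γ) * thY ∣[(2 : ℤ)] γ -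
      thX ∣[(2 : ℤ)] γ * serreDerivative ((2 : ℤ) : ℂ) (thY ∣[(2 : ℤ)] γ) := by
    intro γ
    rw [← serreDerivative_slash_equivariant thX_mdiff, ← serreDerivative_slash_equivariant thY_mdiff,
      ← mul_slash_SL2, ← mul_slash_SL2, thWr, slash_sub]
    rfl
  have hneg : ∀ {f : ℍ → ℂ}, MDiff f → serreDerivative ((2 : ℤ) : ℂ) (-f) =
      -serreDerivative ((2 : ℤ) : ℂ) f := by
    intro f hf
    have := serreDerivative_smul ((2 : ℤ) : ℂ) (-1) f hf
    rwa [neg_one_smul, neg_one_smul] at this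
  have hsub := serreDerivative_sub ((2 : ℤ) : ℂ) thY thX thY_mdiff thX_mdiff
  have hX := serreDerivative_mdifferentiable ((2 : ℤ) : ℂ) thX_mdiff
  have hY := serreDerivative_mdifferentiable ((2 : ℤ) : ℂ) thY_mdiff
  refine ne_zero_of_slash_eq_neg ((hX.mul thY_mdiff).sub (thX_mdiff.mul hY)) ?_ ?_ ?_ ?_ τ
  · change thWr ∣[(6 : ℤ)] ModularGroup.S = -thWr
    rw [e, thX_slash_S, thY_slash_S, hneg thY_mdiff, hneg thW_mdiff, thW_eq, hsub, thWr]
    ring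
  · change thWr ∣[(6 : ℤ)] ModularGroup.T = -thWr
    rw [e, thX_slash_T, thY_slash_T, hneg thX_mdiff, thW_eq, hsub, thWr]
    ring
  · have h1 := ((tendsto_normalizedDeriv thX_mdiff tendsto_thX).mul tendsto_thY).sub
      (tendsto_thX.mul (tendsto_normalizedDeriv thY_mdiff tendsto_thY))
    simp only [zero_mul, mul_zero, sub_zero] at h1
    exact h1.congr fun τ ↦ (thWr_apply τ).symm
  · change thWr ≠ 0
    intro h0
    have hd : ∀ z ∈ {z : ℂ | 0 < z.im}, HasDerivAt lam 0 z := fun z hz ↦ by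
      have := hasDerivAt_lam ⟨z, hz⟩
      rw [h0] at this
      simpa using this
    have hconst : ∀ σ : ℍ, lam σ = lam τ := fun σ ↦
      isOpen_upperHalfPlaneSet.is_const_of_deriv_eq_zero
        (convex_halfSpace_im_gt 0).isPreconnected
        (fun z hz ↦ (hd z hz).differentiableAt.differentiableWithinAt)
        (fun z hz ↦ (hd z hz).deriv) σ.im_pos τ.im_pos
    have h1 : (fun σ : ℍ ↦ lam σ) = fun _ ↦ lam τ := funext hconst
    have h2 := tendsto_lam
    rw [h1] at h2
    exact lam_ne_zero τ (tendsto_nhds_unique tendsto_const_nhds h2)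

lemma deriv_lam_ne_zero (τ : ℍ) : deriv lam τ ≠ 0 := by
  rw [(hasDerivAt_lam τ).deriv]
  exact div_ne_zero (mul_ne_zero two_pi_I_ne_zero (thWr_ne_zero τ))
    (pow_ne_zero 2 (thY_ne_zero τ))

end Derivative

/-! ### Forms for Γ(2) as polynomials in λ, and the values of λ. -/

lemma slash_T_mul_S (k : ℤ) (f : ℍ → ℂ) :
    f ∣[k] (ModularGroup.T * ModularGroup.S) = (f ∣[k] ModularGroup.T) ∣[k] ModularGroup.S :=
  SlashAction.slash_mul _ _ _ _

lemma thX_slash_TS : thX ∣[(2 : ℤ)] (ModularGroup.T * ModularGroup.S) = thW := by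
  rw [slash_T_mul_S, thX_slash_T, SlashAction.neg_slash, thX_slash_S, neg_neg]

lemma thY_slash_TS : thY ∣[(2 : ℤ)] (ModularGroup.T * ModularGroup.S) = -thX := by
  rw [slash_T_mul_S, thY_slash_T, thW_slash_S]

lemma isBoundedAtImInfty_div {f g : ℍ → ℂ} (hf : IsBoundedAtImInfty f) {c : ℂ} (hc : c ≠ 0)
    (hg : Tendsto g atImInfty (𝓝 c)) : IsBoundedAtImInfty (f / g) := by
  rw [div_eq_mul_inv]
  exact hf.mul (isBoundedAtImInfty_of_tendsto (hg.inv₀ hc))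

lemma IsMF.div {k l : ℤ} {f g : ℍ → ℂ} (hf : IsMF k f) (hg : IsMF l g) (h0 : ∀ τ, g τ ≠ 0)
    (h1 : IsBoundedAtImInfty (f / g))
    (h2 : IsBoundedAtImInfty (f ∣[k] ModularGroup.S / g ∣[l] ModularGroup.S))
    (h3 : IsBoundedAtImInfty (f ∣[k] (ModularGroup.T * ModularGroup.S) /
      g ∣[l] (ModularGroup.T * ModularGroup.S))) : IsMF (k - l) (f / g) where
  mdiff := by
    have hf' := UpperHalfPlane.mdifferentiable_iff.mp hf.mdiff
    have hg' := UpperHalfPlane.mdifferentiable_iff.mp hg.mdiff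
    exact UpperHalfPlane.mdifferentiable_iff.mpr (hf'.div hg' fun z _ ↦ h0 _)
  slash_eq γ hγ := by rw [div_slash_SL2, hf.slash_eq γ hγ, hg.slash_eq γ hγ]
  bdd_infty := h1
  bdd_zero := by rwa [div_slash_SL2]
  bdd_one := by rwa [div_slash_SL2]

lemma IsMF.periodic {k : ℤ} {f : ℍ → ℂ} (hf : IsMF k f) :
    Function.Periodic (f ∘ ofComplex) ((2 : ℝ) : ℂ) := by
  refine SlashInvariantFormClass.periodic_comp_ofComplex (Γ := CongruenceSubgroup.Gamma 2) (k := k)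
    hf.toModularForm ?_
  rw [CongruenceSubgroup.strictPeriods_Gamma]
  exact AddSubgroup.mem_zmultiples _

lemma norm_qh (τ : ℍ) : ‖qh τ‖ = rexp (-2 * π * τ.im / 2) := by
  have := norm_cexp_pi_I_mul 1 τ
  simp only [ofReal_one, mul_one] at this
  rw [qh, this, UpperHalfPlane.coe_im]
  congr 1; ring

/-- The cusp ∞ has width 2, so the expansion is in powers of `qh` and the first correction to the
constant term has order `qh`. -/
lemma IsMF.exists_sub_isBigO {k : ℤ} {f : ℍ → ℂ} (hf : IsMF k f) :
    ∃ c : ℂ, (fun τ ↦ f τ - c) =O[atImInfty] qh := by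
  refine ⟨valueAtInfty f, ?_⟩
  refine (exp_decay_sub_atImInfty two_pos hf.periodic hf.mdiff hf.bdd_infty).trans ?_
  refine IsBigO.of_bound 1 (Eventually.of_forall fun τ ↦ ?_)
  rw [norm_qh, Real.norm_of_nonneg (Real.exp_pos _).le, one_mul]

lemma isBigO_qh_thX : qh =O[atImInfty] thX := by
  have h := (tendsto_thX_div_qh.inv₀ (by norm_num)).isBigO_one ℂ
  have h2 := h.mul (isBigO_refl thX atImInfty)
  refine (h2.congr_left fun τ ↦ ?_).trans (by simpa using isBigO_refl thX atImInfty)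
  rw [inv_div, div_mul_cancel₀ _ (thX_ne_zero τ)]

/-- A form for `Γ(2)` of weight `2n` is `Θ₃^(4n)` times a polynomial in `λ`. -/
theorem IsMF.exists_polynomial (n : ℕ) {f : ℍ → ℂ} (hf : IsMF (n * 2) f) :
    ∃ P : Polynomial ℂ, ∀ τ : ℍ, f τ = thY τ ^ n * P.eval (lam τ) := by
  induction n generalizing f with
  | zero =>
    rw [Nat.cast_zero, zero_mul] at hf
    obtain ⟨c, hc⟩ := hf.eq_const
    exact ⟨Polynomial.C c, fun τ ↦ by simp [hc]⟩
  | succ n ih =>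
    obtain ⟨c, hc⟩ := hf.exists_sub_isBigO
    -- As Θ₃⁴ tends to 1, subtracting this multiple of its power removes the value of f at ∞.
    have hg : IsMF ((n + 1 : ℕ) * 2) (f - c • thY ^ (n + 1)) :=
      hf.sub ((thY_isMF.pow (n + 1)).smul c)
    have hY1 : (fun τ ↦ thY τ - 1) =O[atImInfty] qh := by
      have h := (tendsto_thY_sub_one_div_qh.isBigO_one ℂ).mul (isBigO_refl qh atImInfty)
      refine (h.congr_left fun τ ↦ ?_).trans (by simpa using isBigO_refl qh atImInfty)
      rw [div_mul_cancel₀ _ (qh_ne_zero τ)]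
    have hYn : (fun τ ↦ thY τ ^ (n + 1) - 1) =O[atImInfty] qh := by
      have hsum : Tendsto (fun τ ↦ ∑ i ∈ Finset.range (n + 1), thY τ ^ i) atImInfty
          (𝓝 (∑ i ∈ Finset.range (n + 1), 1 ^ i)) :=
        tendsto_finsetSum _ fun i _ ↦ tendsto_thY.pow i
      have := (hsum.isBigO_one ℂ).mul hY1
      refine (this.congr_left fun τ ↦ ?_).trans (by simpa using isBigO_refl qh atImInfty)
      rw [geom_sum_mul]
    have hbig : (f - c • thY ^ (n + 1)) =O[atImInfty] qh := by
      refine (hc.sub (hYn.const_mul_left c)).congr_left fun τ ↦ ?_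
      simp only [Pi.sub_apply, Pi.smul_apply, Pi.pow_apply, smul_eq_mul]
      ring
    -- Division by Θ₂⁴ is harmless: it has no zeros on ℍ, vanishes at ∞ only to order `qh`, and has
    -- limits −1 and 1 at the other two cusps.
    have hdiv : IsMF ((n + 1 : ℕ) * 2 - 2) ((f - c • thY ^ (n + 1)) / thX) := by
      refine hg.div thX_isMF thX_ne_zero ?_ ?_ ?_
      · have h := (hbig.trans isBigO_qh_thX).mul (isBigO_refl (fun τ ↦ (thX τ)⁻¹) atImInfty)
        refine h.trans (IsBigO.of_bound 1 (Eventually.of_forall fun τ ↦ ?_))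
        rw [mul_inv_cancel₀ (thX_ne_zero τ)]
        simp
      · refine isBoundedAtImInfty_div hg.bdd_zero (c := -1) (by norm_num) ?_
        rw [thX_slash_S]
        exact tendsto_thW.neg
      · refine isBoundedAtImInfty_div hg.bdd_one (c := 1) (by norm_num) ?_
        rw [thX_slash_TS]
        exact tendsto_thW
    obtain ⟨Q, hQ⟩ := ih (f := (f - c • thY ^ (n + 1)) / thX) (by
      convert! hdiv using 1
      push_cast; ring)
    refine ⟨Polynomial.C c + Polynomial.X * Q, fun τ ↦ ?_⟩
    have h := hQ τ
    simp only [Pi.sub_apply, Pi.smul_apply, Pi.pow_apply, Pi.div_apply, smul_eq_mul] at h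
    rw [div_eq_iff (thX_ne_zero τ), sub_eq_iff_eq_add] at h
    rw [h, Polynomial.eval_add, Polynomial.eval_mul, Polynomial.eval_C, Polynomial.eval_X,
      lam_eq_thX_div_thY]
    have := thY_ne_zero τ
    field_simp
    ring

/-- The modular lambda function takes every value except `0` and `1`. -/
theorem exists_lam_eq {w : ℂ} (h0 : w ≠ 0) (h1 : w ≠ 1) : ∃ τ : ℍ, lam τ = w := by
  by_contra! hne
  -- If w were omitted, this form would have no zeros on ℍ. Its limits at the three cusps are −w, w
  -- − 1 and 1, all nonzero, so its inverse would be a form of weight −2.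
  have hg : IsMF 2 (thX - w • thY) := thX_isMF.sub (thY_isMF.smul w)
  have hg0 : ∀ τ, (thX - w • thY) τ ≠ 0 := by
    intro τ h
    apply hne τ
    rw [lam_eq_thX_div_thY, div_eq_iff (thY_ne_zero τ)]
    exact sub_eq_zero.mp h
  have hone : ∀ γ : SL(2, ℤ), IsBoundedAtImInfty ((1 : ℍ → ℂ) ∣[(0 : ℤ)] γ) := isMF_one.bdd
  have hinv : IsMF (0 - 2) (1 / (thX - w • thY)) := by
    refine isMF_one.div hg hg0 ?_ ?_ ?_
    · refine isBoundedAtImInfty_div isMF_one.bdd_infty (c := 0 - w * 1) (by simpa using h0) ?_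
      exact tendsto_thX.sub (tendsto_thY.const_mul w)
    · refine isBoundedAtImInfty_div (hone _) (c := -1 - w * (-1)) ?_ ?_
      · intro h
        exact h1 (by linear_combination h)
      · rw [slash_sub, SL_smul_slash, thX_slash_S, thY_slash_S]
        exact tendsto_thW.neg.sub (tendsto_thY.neg.const_mul w)
    · refine isBoundedAtImInfty_div (hone _) (c := 1 - w * (-0)) (by simp) ?_
      rw [slash_sub, SL_smul_slash, thX_slash_TS, thY_slash_TS]
      exact tendsto_thW.sub (tendsto_thX.neg.const_mul w)
  have hz := congrFun (hinv.eq_zero_of_neg (by norm_num)) UpperHalfPlane.I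
  simp only [Pi.div_apply, Pi.one_apply, Pi.zero_apply, one_div, inv_eq_zero] at hz
  exact hg0 _ hz

/-! ### Recovering the values of a family from its power sums. -/

section PowerSums

open Polynomial

lemma tsum_eval_X_sq_mul_eq {ι κ : Type*} {x : ι → ℂ} {y : κ → ℂ}
    (hx : ∀ m, 2 ≤ m → Summable fun i ↦ x i ^ m) (hy : ∀ m, 2 ≤ m → Summable fun j ↦ y j ^ m)
    (h : ∀ m, 2 ≤ m → ∑' i, x i ^ m = ∑' j, y j ^ m) (p : ℂ[X]) :
    ∑' i, x i ^ 2 * p.eval (x i) = ∑' j, y j ^ 2 * p.eval (y j) := by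
  have e : ∀ t : ℂ, t ^ 2 * p.eval t =
      ∑ n ∈ Finset.range (p.natDegree + 1), p.coeff n * t ^ (n + 2) := by
    intro t
    rw [eval_eq_sum_range, Finset.mul_sum]
    exact Finset.sum_congr rfl fun n _ ↦ by ring
  simp_rw [e]
  rw [Summable.tsum_finsetSum fun n _ ↦ (hx (n + 2) (by omega)).mul_left _,
    Summable.tsum_finsetSum fun n _ ↦ (hy (n + 2) (by omega)).mul_left _]
  refine Finset.sum_congr rfl fun n _ ↦ ?_
  rw [tsum_mul_left, tsum_mul_left, h (n + 2) (by omega)]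

lemma summable_pow_of_summable_norm_sq {ι : Type*} {x : ι → ℂ}
    (hx : Summable fun i ↦ ‖x i‖ ^ 2) {m : ℕ} (hm : 2 ≤ m) : Summable fun i ↦ x i ^ m := by
  refine Summable.of_norm_bounded_eventually hx ?_
  have h1 : ∀ᶠ i in cofinite, ‖x i‖ ^ 2 < 1 :=
    hx.tendsto_cofinite_zero.eventually_lt_const one_pos
  filter_upwards [h1] with i hi
  rw [norm_pow]
  exact pow_le_pow_of_le_one (norm_nonneg _)
    (by nlinarith [norm_nonneg (x i)]) hm

/-- The limit of test polynomials `t ^ (N + 2) * p t` summed over a square summable family, for a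
polynomial `p` that vanishes at all large elements of the family other than `1`. -/
lemma tendsto_tsum_pow_mul_eval {ι : Type*} {x : ι → ℂ} (hx : Summable fun i ↦ ‖x i‖ ^ 2)
    {p : ℂ[X]} (hp1 : p.eval 1 = 1) (hp : ∀ i, 1 / 2 ≤ ‖x i‖ → x i ≠ 1 → p.eval (x i) = 0) :
    Tendsto (fun N : ℕ ↦ ∑' i, x i ^ 2 * (X ^ N * p).eval (x i)) atTop
      (𝓝 (∑' i, if x i = 1 then 1 else 0)) := by
  obtain ⟨C, hC⟩ := (isCompact_closedBall (0 : ℂ) (1 / 2)).exists_bound_of_continuousOn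
    (f := fun t ↦ p.eval t) p.continuous.continuousOn
  refine tendsto_tsum_of_dominated_convergence (hx.mul_left (max C 1)) (fun i ↦ ?_)
    (Eventually.of_forall fun N i ↦ ?_)
  · split_ifs with h1
    · simp [h1, hp1]
    · rcases le_or_gt (1 / 2) ‖x i‖ with h2 | h2
      · simp [hp i h2 h1]
      · have h3 : Tendsto (fun N : ℕ ↦ x i ^ N) atTop (𝓝 0) :=
          tendsto_pow_atTop_nhds_zero_of_norm_lt_one (by linarith)
        have h4 := (h3.mul_const (p.eval (x i))).const_mul (x i ^ 2)
        simpa using h4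
  · rw [norm_mul, norm_pow, mul_comm]
    refine mul_le_mul_of_nonneg_right ?_ (by positivity)
    rw [eval_mul, eval_pow, eval_X, norm_mul, norm_pow]
    by_cases h1 : x i = 1
    · simp [h1, hp1]
    · rcases le_or_gt (1 / 2) ‖x i‖ with h2 | h2
      · rw [hp i h2 h1, norm_zero, mul_zero]
        exact zero_le_one.trans (le_max_right _ _)
      · have h5 : ‖p.eval (x i)‖ ≤ C := hC _ (by simpa using h2.le)
        have h6 : ‖x i‖ ^ N ≤ 1 := pow_le_one₀ (norm_nonneg _) (by linarith)
        calc _ ≤ 1 * C := mul_le_mul h6 h5 (norm_nonneg _) zero_le_one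
          _ ≤ _ := by rw [one_mul]; exact le_max_left _ _

lemma finite_half_le_norm {ι : Type*} {x : ι → ℂ} (hx : Summable fun i ↦ ‖x i‖ ^ 2) :
    {i | 1 / 2 ≤ ‖x i‖}.Finite := by
  have h1 : ∀ᶠ i in cofinite, ‖x i‖ ^ 2 < 1 / 4 :=
    hx.tendsto_cofinite_zero.eventually_lt_const (by norm_num)
  refine (eventually_cofinite.mp h1).subset fun i hi ↦ ?_
  simp only [Set.mem_ofPred_eq] at hi ⊢
  nlinarith

/-- The power sums of order at least `2` of a square summable family determine its nonzero
values. -/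
theorem exists_eq_of_tsum_pow_eq {ι κ : Type*} {x : ι → ℂ} {y : κ → ℂ}
    (hx : Summable fun i ↦ ‖x i‖ ^ 2) (hy : Summable fun j ↦ ‖y j‖ ^ 2)
    (h : ∀ m, 2 ≤ m → ∑' i, x i ^ m = ∑' j, y j ^ m) {i₀ : ι} (h0 : x i₀ ≠ 0) :
    ∃ j, y j = x i₀ := by
  classical
  by_contra! hne
  -- After scaling, the value to be found is 1, and `v` is assumed to omit it.
  set u : ι → ℂ := fun i ↦ x i / x i₀
  set v : κ → ℂ := fun j ↦ y j / x i₀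
  have hu : Summable fun i ↦ ‖u i‖ ^ 2 := by
    simpa [u, div_pow] using hx.div_const (‖x i₀‖ ^ 2)
  have hv : Summable fun j ↦ ‖v j‖ ^ 2 := by
    simpa [v, div_pow] using hy.div_const (‖x i₀‖ ^ 2)
  have huv : ∀ m, 2 ≤ m → ∑' i, u i ^ m = ∑' j, v j ^ m := by
    intro m hm
    simp only [u, v, div_pow, tsum_div_const, h m hm]
  have hv1 : ∀ j, v j ≠ 1 := fun j hj ↦ hne j ((div_eq_one_iff_eq h0).mp hj)
  -- The finitely many other values of norm at least 1/2 are killed by the interpolating polynomial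
  -- `p`, which is 1 at 1. The smaller values are killed by t^N as N → ∞, so in the limit the test
  -- sums count the occurrences of 1.
  set B : Finset ℂ := (((finite_half_le_norm hu).toFinset.image u) ∪
    ((finite_half_le_norm hv).toFinset.image v)).erase 1
  set p : ℂ[X] := ∏ b ∈ B, C (1 - b)⁻¹ * (X - C b)
  have hB1 : ∀ b ∈ B, 1 - b ≠ 0 := fun b hb ↦ sub_ne_zero.mpr (Finset.ne_of_mem_erase hb).symm
  have hp1 : p.eval 1 = 1 := by
    rw [eval_prod]
    refine Finset.prod_eq_one fun b hb ↦ ?_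
    simp [inv_mul_cancel₀ (hB1 b hb)]
  have hpB : ∀ b ∈ B, p.eval b = 0 := fun b hb ↦ by
    rw [eval_prod]
    exact Finset.prod_eq_zero hb (by simp)
  have hpu : ∀ i, 1 / 2 ≤ ‖u i‖ → u i ≠ 1 → p.eval (u i) = 0 := fun i hi hi1 ↦ by
    refine hpB _ (Finset.mem_erase.mpr ⟨hi1, Finset.mem_union_left _ ?_⟩)
    exact Finset.mem_image_of_mem _ ((Set.Finite.mem_toFinset _).mpr hi)
  have hpv : ∀ j, 1 / 2 ≤ ‖v j‖ → v j ≠ 1 → p.eval (v j) = 0 := fun j hj hj1 ↦ by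
    refine hpB _ (Finset.mem_erase.mpr ⟨hj1, Finset.mem_union_right _ ?_⟩)
    exact Finset.mem_image_of_mem _ ((Set.Finite.mem_toFinset _).mpr hj)
  have hlim := tendsto_tsum_pow_mul_eval hv hp1 hpv
  simp_rw [← tsum_eval_X_sq_mul_eq (fun m hm ↦ summable_pow_of_summable_norm_sq hu hm)
    (fun m hm ↦ summable_pow_of_summable_norm_sq hv hm) huv] at hlim
  have heq := tendsto_nhds_unique (tendsto_tsum_pow_mul_eval hu hp1 hpu) hlim
  simp only [hv1, if_false, tsum_zero] at heq
  rw [tsum_eq_sum (s := (finite_half_le_norm hu).toFinset), Finset.sum_boole, Nat.cast_eq_zero,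
    Finset.card_eq_zero, Finset.filter_eq_empty_iff] at heq
  · have hu0 : u i₀ = 1 := div_self h0
    exact heq (x := i₀) ((Set.Finite.mem_toFinset _).mpr (by simp [hu0]; norm_num)) hu0
  · intro i hi
    rw [if_neg]
    intro hi1
    exact hi ((Set.Finite.mem_toFinset _).mpr (by simp [hi1]; norm_num))

end PowerSums

/-! ### Injectivity of λ on Γ(2)-orbits. -/

section Injectivity

open EisensteinSeries

lemma eisSummand_mul_two (m : ℕ) (v : Fin 2 → ℤ) (τ : ℍ) :
    eisSummand ((m : ℤ) * 2) v τ = eisSummand 2 v τ ^ m := by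
  rw [eisSummand, eisSummand, ← zpow_natCast, ← zpow_mul]
  congr 1
  ring

lemma linear_ne_zero_of_mem_gammaSet {a : Fin 2 → ZMod 2} {v : Fin 2 → ℤ}
    (hv : v ∈ gammaSet 2 1 a) (τ : ℍ) : (v 0 * τ + v 1 : ℂ) ≠ 0 := by
  have hv0 : (fun i ↦ (v i : ℝ)) ≠ 0 := by
    intro h
    have h0 : v 0 = 0 := by simpa using congrFun h 0
    have h1 : v 1 = 0 := by simpa using congrFun h 1
    have := hv.2
    simp [h0, h1] at this
  simpa using linear_ne_zero τ hv0

lemma summable_norm_eisSummand_two_sq (a : Fin 2 → ZMod 2) (τ : ℍ) :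
    Summable fun w : gammaSet 2 1 a ↦ ‖eisSummand 2 w.1 τ‖ ^ 2 := by
  have := (summable_norm_eisSummand (k := 4) (by norm_num) τ).subtype (gammaSet 2 1 a)
  refine this.congr fun w ↦ ?_
  rw [← norm_pow, ← eisSummand_mul_two]
  rfl

/-- The m-th power sum is an Eisenstein series of weight 2m, to which the structure theorem applies;
m ≥ 2 ensures convergence. -/
lemma exists_tsum_eisSummand_pow_eq (a : Fin 2 → ZMod 2) {m : ℕ} (hm : 2 ≤ m) :
    ∃ P : Polynomial ℂ, ∀ τ : ℍ, ∑' w : gammaSet 2 1 a, eisSummand 2 w.1 τ ^ m =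
      thY τ ^ m * P.eval (lam τ) := by
  obtain ⟨P, hP⟩ := (isMF_of_modularForm
    (ModularForm.eisensteinSeriesMF (k := (m : ℤ) * 2) (by omega) a)).exists_polynomial m
  refine ⟨P, fun τ ↦ ?_⟩
  rw [← hP τ]
  change _ = ∑' w : gammaSet 2 1 a, eisSummand ((m : ℤ) * 2) w.1 τ
  exact tsum_congr fun w ↦ (eisSummand_mul_two m w.1 τ).symm

/-- The families (vτ)^(−2) and u²(wσ)^(−2) have equal power sums of order at least 2, hence equal
values. Taking square roots leaves a sign, which does not affect residues modulo 2. -/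
lemma exists_mul_eq_of_lam_eq {τ σ : ℍ} (h : lam τ = lam σ) {u : ℂ}
    (hu : u ^ 2 * thY σ = thY τ) (a : Fin 2 → ZMod 2) (v : Fin 2 → ℤ) (hv : v ∈ gammaSet 2 1 a) :
    ∃ c d : ℤ, (c : ZMod 2) = a 0 ∧ (d : ZMod 2) = a 1 ∧
      (c * σ + d : ℂ) = u * (v 0 * τ + v 1) := by
  have hy : Summable fun w : gammaSet 2 1 a ↦ ‖u ^ 2 * eisSummand 2 w.1 σ‖ ^ 2 := by
    simp_rw [norm_mul, mul_pow]
    exact (summable_norm_eisSummand_two_sq a σ).mul_left _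
  have hpow : ∀ m, 2 ≤ m → ∑' w : gammaSet 2 1 a, eisSummand 2 w.1 τ ^ m =
      ∑' w : gammaSet 2 1 a, (u ^ 2 * eisSummand 2 w.1 σ) ^ m := by
    intro m hm
    obtain ⟨P, hP⟩ := exists_tsum_eisSummand_pow_eq a hm
    simp_rw [mul_pow]
    rw [tsum_mul_left, hP, hP, h, ← hu]
    ring
  have h2 := linear_ne_zero_of_mem_gammaSet hv τ
  have hx0 : eisSummand 2 v τ ≠ 0 := zpow_ne_zero _ h2
  obtain ⟨⟨w, hwm⟩, hw⟩ := exists_eq_of_tsum_pow_eq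
    (x := fun w : gammaSet 2 1 a ↦ eisSummand 2 w.1 τ)
    (summable_norm_eisSummand_two_sq a τ) hy hpow (i₀ := ⟨v, hv⟩) hx0
  have h1 := linear_ne_zero_of_mem_gammaSet hwm σ
  have hw' : (w 0 * σ + w 1 : ℂ) ^ 2 = (u * (v 0 * τ + v 1)) ^ 2 := by
    change u ^ 2 * (w 0 * σ + w 1 : ℂ) ^ (-2 : ℤ) = (v 0 * τ + v 1 : ℂ) ^ (-2 : ℤ) at hw
    field_simp at hw
    rw [mul_pow, ← hw]
  have hw0 : ((w 0 : ℤ) : ZMod 2) = a 0 := congrFun hwm.1 0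
  have hw1 : ((w 1 : ℤ) : ZMod 2) = a 1 := congrFun hwm.1 1
  rcases sq_eq_sq_iff_eq_or_eq_neg.mp hw' with h4 | h4
  · exact ⟨w 0, w 1, hw0, hw1, h4⟩
  · refine ⟨-w 0, -w 1, ?_, ?_, ?_⟩
    · push_cast; rw [hw0, ZMod.neg_eq_self_mod_two]
    · push_cast; rw [hw1, ZMod.neg_eq_self_mod_two]
    · push_cast; linear_combination -h4

/-- The vectors (1, 0) and (0, 1) express uτ and u through σ and 1. The last equation compares
areas, and forces the determinant to be positive. -/
lemma exists_matrix_of_lam_eq {τ σ : ℍ} (h : lam τ = lam σ) {u : ℂ}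
    (hu : u ^ 2 * thY σ = thY τ) : ∃ a b c d : ℤ, (a : ZMod 2) = 1 ∧ (b : ZMod 2) = 0 ∧
      (c : ZMod 2) = 0 ∧ (d : ZMod 2) = 1 ∧ (a * σ + b : ℂ) = u * τ ∧ (c * σ + d : ℂ) = u ∧
      normSq u * τ.im = (a * d - b * c : ℤ) * σ.im := by
  obtain ⟨a, b, ha, hb, h1⟩ := exists_mul_eq_of_lam_eq h hu ![1, 0] ![1, 0]
    ⟨by ext i; fin_cases i <;> simp, by simp⟩
  obtain ⟨c, d, hc, hd, h2⟩ := exists_mul_eq_of_lam_eq h hu ![0, 1] ![0, 1]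
    ⟨by ext i; fin_cases i <;> simp, by simp⟩
  simp only [Matrix.cons_val_zero, Matrix.cons_val_one, Int.cast_one, Int.cast_zero, one_mul,
    add_zero, zero_mul, zero_add, mul_one] at ha hb hc hd h1 h2
  refine ⟨a, b, c, d, ha, hb, hc, hd, h1, h2, ?_⟩
  have e1 := congrArg Complex.re h1
  have e2 := congrArg Complex.im h1
  have e3 := congrArg Complex.re h2
  have e4 := congrArg Complex.im h2
  simp only [add_re, add_im, mul_re, mul_im, intCast_re, intCast_im, zero_mul, sub_zero,
    UpperHalfPlane.coe_re, UpperHalfPlane.coe_im, add_zero] at e1 e2 e3 e4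
  rw [normSq_apply]
  push_cast
  have : (u.re * u.re + u.im * u.im) * τ.im =
      u.re * (u.re * τ.im + u.im * τ.re) - u.im * (u.re * τ.re - u.im * τ.im) := by ring
  rw [this, ← e1, ← e2, ← e3, ← e4]
  ring

/-- The modular lambda function separates the orbits of `Γ(2)`. -/
theorem exists_smul_eq_of_lam_eq {τ σ : ℍ} (h : lam τ = lam σ) :
    ∃ γ ∈ CongruenceSubgroup.Gamma 2, γ • σ = τ := by
  obtain ⟨u, hu⟩ := IsAlgClosed.exists_pow_nat_eq (thY τ / thY σ) two_pos
  have hu' : u ^ 2 * thY σ = thY τ := by rw [hu, div_mul_cancel₀ _ (thY_ne_zero σ)]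
  have hu0 : u ≠ 0 := by
    rintro rfl
    exact thY_ne_zero τ (by simpa using hu'.symm)
  obtain ⟨a, b, c, d, ha, hb, hc, hd, h1, h2, h3⟩ := exists_matrix_of_lam_eq h hu'
  -- Exchanging τ and σ gives a second integer determinant. The area factors are inverse to each
  -- other, so the two determinants have product 1.
  obtain ⟨a', b', c', d', -, -, -, -, -, -, h3'⟩ := exists_matrix_of_lam_eq h.symm (u := u⁻¹)
    (by rw [← hu']; field_simp)
  have hn : 0 < normSq u := normSq_pos.mpr hu0
  rw [map_inv₀] at h3'
  have hdet : 0 < a * d - b * c := by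
    have : 0 < ((a * d - b * c : ℤ) : ℝ) * σ.im := h3 ▸ mul_pos hn τ.im_pos
    exact_mod_cast (pos_iff_pos_of_mul_pos this).mpr σ.im_pos
  have hprod : (a * d - b * c) * (a' * d' - b' * c') = 1 := by
    have : ((a * d - b * c : ℤ) : ℝ) * ((a' * d' - b' * c' : ℤ) : ℝ) * (σ.im * τ.im) =
        1 * (σ.im * τ.im) := by
      calc _ = (((a * d - b * c : ℤ) : ℝ) * σ.im) * (((a' * d' - b' * c' : ℤ) : ℝ) * τ.im) := by
            ring
        _ = _ := by rw [← h3, ← h3']; field_simp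
    exact_mod_cast mul_right_cancel₀ (mul_pos σ.im_pos τ.im_pos).ne' this
  have hdet1 : a * d - b * c = 1 := Int.eq_one_of_mul_eq_one_right hdet.le hprod
  let γ : SL(2, ℤ) := ⟨!![a, b; c, d], by rw [Matrix.det_fin_two_of]; exact hdet1⟩
  refine ⟨γ, CongruenceSubgroup.Gamma_mem.mpr ⟨ha, hb, hc, hd⟩, UpperHalfPlane.ext ?_⟩
  have e : ((γ • σ : ℍ) : ℂ) = (a * σ + b) / (c * σ + d) := by
    rw [UpperHalfPlane.coe_specialLinearGroup_apply]
    simp [γ]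
  rw [e, h1, h2, mul_div_cancel_left₀ _ hu0]

end Injectivity

/-! ### Lipschitz formula and the rows without coprimality. -/

/-- The sum `∑ (w + d)^(-m)` over all integers `d`. -/
noncomputable def lipschitzSum (m : ℕ) (w : ℂ) : ℂ := ∑' d : ℤ, 1 / (w + d) ^ m

/-- The constant of the Lipschitz formula. -/
noncomputable def lipschitzConst (m : ℕ) : ℂ := (-2 * π * Complex.I) ^ m / (Nat.factorial (m - 1))

/-- The power series `∑ σ_k(n) q^n`. -/
noncomputable def sigmaSeries (k : ℕ) (q : ℂ) : ℂ :=
  ∑' n : ℕ+, (ArithmeticFunction.sigma k n : ℂ) * q ^ (n : ℕ)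

/-- Each row is a power series in q^n with coefficients b^(m−1); collecting the double sum by the
product nb produces the divisor sums. -/
lemma hasSum_lipschitzSum {m : ℕ} (hm : 2 ≤ m) {z : ℂ} (hz : 0 < z.im) :
    HasSum (fun n : ℕ+ ↦ lipschitzSum m (n * z))
      (lipschitzConst m * sigmaSeries (m - 1) (cexp (2 * π * Complex.I * z))) := by
  have hr := UpperHalfPlane.norm_exp_two_pi_I_lt_one ⟨z, hz⟩
  have h1 := (summable_prod_mul_pow (m - 1) hr).prod
  have h2 := h1.hasSum
  simp only at h2
  rw [tsum_prod_pow_eq_tsum_sigma (m - 1) hr] at h2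
  refine (h2.mul_left (lipschitzConst m)).congr_fun ?_
  intro n
  have hn : 0 < ((n : ℂ) * z).im := by
    have : ((n : ℂ) * z).im = n * z.im := by simp
    rw [this]; positivity
  have := EisensteinSeries.qExpansion_identity_pnat (k := m - 1) (by omega) ⟨n * z, hn⟩
  rw [Nat.sub_add_cancel (by omega)] at this
  rw [lipschitzSum, this, lipschitzConst]
  congr 1
  refine tsum_congr fun b ↦ ?_
  congr 1
  rw [pow_mul, ← Complex.exp_nat_mul _ (n : ℕ)]
  congr 2
  push_cast
  ring

lemma summable_ite_linear {m : ℕ} (hm : 2 ≤ m) (z : ℂ) (c : ℤ) (p : ℤ → Prop) [DecidablePred p] :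
    Summable fun d : ℤ ↦ if p d then 1 / ((c : ℂ) * z + d) ^ m else 0 := by
  have h := EisensteinSeries.linear_right_summable z c (k := m) (by exact_mod_cast hm)
  refine Summable.of_norm_bounded h.norm fun d ↦ ?_
  split_ifs <;> simp

lemma tsum_even_linear (m : ℕ) (w : ℂ) :
    ∑' d : ℤ, (if d ≡ 0 [ZMOD 2] then 1 / (w + d) ^ m else 0) =
      ((2 : ℂ) ^ m)⁻¹ * lipschitzSum m (w / 2) := by
  have hinj : Function.Injective (fun d : ℤ ↦ 2 * d) := fun a b h ↦ by simpa using h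
  rw [← hinj.tsum_eq, lipschitzSum, ← tsum_mul_left]
  · refine tsum_congr fun d ↦ ?_
    rw [if_pos (by simp [Int.modEq_zero_iff_dvd])]
    rw [one_div, one_div, ← mul_inv, ← mul_pow]
    push_cast
    congr 2
    ring
  · intro d hd
    have : d ≡ 0 [ZMOD 2] := by
      by_contra h
      simp [h] at hd
    obtain ⟨e, rfl⟩ := (Int.modEq_zero_iff_dvd).1 this
    exact ⟨e, rfl⟩

lemma tsum_odd_linear {m : ℕ} (hm : 2 ≤ m) (w : ℂ) :
    ∑' d : ℤ, (if d ≡ 1 [ZMOD 2] then 1 / (w + d) ^ m else 0) =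
      lipschitzSum m w - ((2 : ℂ) ^ m)⁻¹ * lipschitzSum m (w / 2) := by
  have h0 := summable_ite_linear hm w 1 (fun d ↦ d ≡ 0 [ZMOD 2])
  have h1 := summable_ite_linear hm w 1 (fun d ↦ True)
  simp only [Int.cast_one, one_mul, if_true] at h0 h1
  rw [← tsum_even_linear, lipschitzSum, ← h1.tsum_sub h0]
  refine tsum_congr fun d ↦ ?_
  rcases Int.emod_two_eq_zero_or_one d with h | h <;> simp [Int.ModEq, h]

/-- The inner sum of `S m a b z`. -/
noncomputable def rowCoprime (m : ℕ) (a b : ℤ) (z : ℂ) (c : ℤ) : ℂ :=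
  ∑' d : ℤ, if c ≡ a [ZMOD 2] ∧ d ≡ b [ZMOD 2] ∧ IsCoprime c d then 1 / ((c : ℂ) * z + d) ^ m else 0

/-- The inner sum of `S m a b z` without the coprimality condition. -/
noncomputable def row (m : ℕ) (a b : ℤ) (z : ℂ) (c : ℤ) : ℂ :=
  ∑' d : ℤ, if c ≡ a [ZMOD 2] ∧ d ≡ b [ZMOD 2] then 1 / ((c : ℂ) * z + d) ^ m else 0

lemma row_zero_one {m : ℕ} (hm : 2 ≤ m) (z : ℂ) (c : ℤ) :
    row m 0 1 z c = if c ≡ 0 [ZMOD 2] then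
      lipschitzSum m (c * z) - ((2 : ℂ) ^ m)⁻¹ * lipschitzSum m (c * z / 2) else 0 := by
  by_cases h : c ≡ 0 [ZMOD 2]
  · simp only [row, h, true_and, if_true]
    exact tsum_odd_linear hm _
  · simp [row, h]

lemma row_one_zero (m : ℕ) (z : ℂ) (c : ℤ) :
    row m 1 0 z c = if c ≡ 1 [ZMOD 2] then
      ((2 : ℂ) ^ m)⁻¹ * lipschitzSum m (c * z / 2) else 0 := by
  by_cases h : c ≡ 1 [ZMOD 2]
  · simp only [row, h, true_and, if_true]
    exact tsum_even_linear m _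
  · simp [row, h]

lemma hasSum_even_pnat {f : ℕ+ → ℂ} {s : ℂ} (h : HasSum (fun n ↦ f (2 * n)) s) :
    HasSum (fun n : ℕ+ ↦ if ((n : ℕ) : ℤ) ≡ 0 [ZMOD 2] then f n else 0) s := by
  have hinj : Function.Injective (fun n : ℕ+ ↦ 2 * n) := fun a b h ↦ by simpa using h
  rw [← hinj.hasSum_iff]
  · refine h.congr_fun fun n ↦ ?_
    simp [Int.modEq_zero_iff_dvd]
  · intro n hn
    rw [if_neg]
    intro h2
    obtain ⟨e, he⟩ := (Int.modEq_zero_iff_dvd).1 h2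
    have hn0 := n.pos
    refine hn ⟨⟨e.toNat, by omega⟩, PNat.eq ?_⟩
    change 2 * e.toNat = n
    omega

/-- With c = 2n, the odd d are all d minus the even d, and halving c·z + d in the even part turns
2nz into nz. -/
lemma hasSum_row_zero_one {m : ℕ} (hm : 2 ≤ m) {z : ℂ} (hz : 0 < z.im) :
    HasSum (fun n : ℕ+ ↦ row m 0 1 z ((n : ℕ) : ℤ)) (lipschitzConst m *
      (sigmaSeries (m - 1) (cexp (2 * π * Complex.I * (2 * z))) -
        ((2 : ℂ) ^ m)⁻¹ * sigmaSeries (m - 1) (cexp (2 * π * Complex.I * z)))) := by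
  simp_rw [row_zero_one hm]
  refine hasSum_even_pnat (f := fun n ↦ lipschitzSum m (((n : ℕ) : ℤ) * z) - ((2 : ℂ) ^ m)⁻¹ *
    lipschitzSum m (((n : ℕ) : ℤ) * z / 2)) ?_
  have h1 := hasSum_lipschitzSum hm (z := 2 * z) (by simpa using hz)
  have h2 := (hasSum_lipschitzSum hm hz).mul_left ((2 : ℂ) ^ m)⁻¹
  rw [mul_sub, mul_left_comm (lipschitzConst m)]
  refine (h1.sub h2).congr_fun fun n ↦ ?_
  have hn : ((((2 * n : ℕ+) : ℕ) : ℤ) : ℂ) = 2 * n := by push_cast; rfl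
  rw [hn, show (2 : ℂ) * n * z = n * (2 * z) by ring, show (n : ℂ) * (2 * z) / 2 = n * z by ring]

lemma hasSum_row_one_zero {m : ℕ} (hm : 2 ≤ m) {z : ℂ} (hz : 0 < z.im) :
    HasSum (fun n : ℕ+ ↦ row m 1 0 z ((n : ℕ) : ℤ)) (lipschitzConst m * (((2 : ℂ) ^ m)⁻¹ *
      (sigmaSeries (m - 1) (cexp (2 * π * Complex.I * (z / 2))) -
        sigmaSeries (m - 1) (cexp (2 * π * Complex.I * z))))) := by
  have h1 := (hasSum_lipschitzSum hm (z := z / 2) (by simpa using hz)).mul_left ((2 : ℂ) ^ m)⁻¹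
  have h2 := (hasSum_lipschitzSum hm hz).mul_left ((2 : ℂ) ^ m)⁻¹
  have h3 := hasSum_even_pnat (f := fun n ↦ ((2 : ℂ) ^ m)⁻¹ *
    lipschitzSum m (((n : ℕ) : ℤ) * z / 2)) (h2.congr_fun fun n ↦ by
      congr 2; push_cast; ring)
  rw [mul_left_comm, mul_sub, mul_sub]
  refine (h1.sub h3).congr_fun fun n ↦ ?_
  rw [row_one_zero, mul_div_assoc]
  rcases Int.emod_two_eq_zero_or_one ((n : ℕ) : ℤ) with h | h <;> simp [Int.ModEq, h]

/-! ### Restoring coprimality, and the Fourier expansion of E. -/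

lemma rowCoprime_even {m : ℕ} (hm : Even m) (a b : ℤ) (z : ℂ) :
    (rowCoprime m a b z).Even := by
  intro c
  have hneg : ∀ x y : ℤ, -x ≡ y [ZMOD 2] ↔ x ≡ y [ZMOD 2] := fun x y ↦ by
    simp only [Int.ModEq]; omega
  rw [rowCoprime, ← tsum_comp_neg, rowCoprime]
  refine tsum_congr fun d ↦ ?_
  simp only [hneg, IsCoprime.neg_neg_iff]
  push_cast
  rw [show -(c : ℂ) * z + -d = -(c * z + d) by ring, hm.neg_pow]

lemma rowCoprime_zero {m : ℕ} (hm : Even m) (z : ℂ) : rowCoprime m 0 1 z 0 = 2 := by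
  rw [rowCoprime, tsum_eq_sum (s := {1, -1})]
  · rw [Finset.sum_pair (by norm_num)]
    have : (-1 : ℤ) ≡ 1 [ZMOD 2] := by decide
    simp [this, hm.neg_pow]
    norm_num
  · intro d hd
    rw [if_neg]
    rintro ⟨-, -, h⟩
    rw [isCoprime_zero_left, Int.isUnit_iff] at h
    simp at hd
    tauto

lemma rowCoprime_zero' (m : ℕ) (z : ℂ) : rowCoprime m 1 0 z 0 = 0 := by
  have : ¬ (0 : ℤ) ≡ 1 [ZMOD 2] := by decide
  simp [rowCoprime, this]

-- Weighting by n^m turns the relation between f and g into a Dirichlet convolution of L-series at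
-- m. The factor χ has convolution inverse χμ, and applying it to the summable g gives the
-- summability of f, which is not assumed.
open LSeries.notation in
lemma hasSum_of_eq_convolution {N : ℕ} (χ : DirichletCharacter ℂ N) {m : ℕ} (hm : 2 ≤ m)
    {f g : ℕ → ℂ} (h : ∀ n ≠ 0, g n =
      ∑ p ∈ n.divisorsAntidiagonal, χ (p.1 : ZMod N) * ((p.1 : ℂ) ^ m)⁻¹ * f p.2) {s : ℂ}
    (hg : HasSum (fun n : ℕ+ ↦ g n) s) :
    Summable (fun n : ℕ+ ↦ f n) ∧
      LSeries (fun n : ℕ ↦ χ (n : ZMod N)) m * ∑' n : ℕ+, f n = s := by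
  set X : ℕ → ℂ := fun n : ℕ ↦ χ (n : ZMod N)
  set M : ℕ → ℂ := X * (fun n ↦ (ArithmeticFunction.moebius n : ℂ)) with hM
  set F : ℕ → ℂ := fun n ↦ (n : ℂ) ^ m * f n with hF
  set G : ℕ → ℂ := fun n ↦ (n : ℂ) ^ m * g n with hG
  have hre : 1 < ((m : ℂ)).re := by
    rw [Complex.natCast_re]; exact_mod_cast hm
  have hXs : LSeriesSummable X m := DirichletCharacter.LSeriesSummable_of_one_lt_re χ hre
  have hMs : LSeriesSummable M m :=
    DirichletCharacter.LSeriesSummable_mul χ <|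
      ArithmeticFunction.LSeriesSummable_moebius_iff.mpr hre
  have hterm : ∀ (u : ℕ → ℂ) (n : ℕ), LSeries.term (fun n ↦ (n : ℂ) ^ m * u n) m n =
      if n = 0 then 0 else u n := by
    intro u n
    rcases eq_or_ne n 0 with rfl | hn
    · simp
    · rw [LSeries.term_of_ne_zero hn, if_neg hn, Complex.cpow_natCast]
      have : (n : ℂ) ^ m ≠ 0 := pow_ne_zero _ (by exact_mod_cast hn)
      field_simp
  have hpn : ∀ (u : ℕ → ℂ) (t : ℂ), HasSum (fun n : ℕ+ ↦ u n) t ↔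
      LSeriesHasSum (fun n ↦ (n : ℂ) ^ m * u n) m t := by
    intro u t
    rw [LSeriesHasSum, funext (hterm u), ← PNat.coe_injective.hasSum_iff]
    · simp [Function.comp_def]
    · intro n hn
      rcases eq_or_ne n 0 with rfl | h0
      · simp
      · exact absurd ⟨⟨n, Nat.pos_of_ne_zero h0⟩, rfl⟩ hn
  have hGs : LSeriesHasSum G m s := (hpn g s).1 hg
  have hconv : G = X ⍟ F := by
    rw [LSeries.convolution_def]
    funext n
    rcases eq_or_ne n 0 with rfl | hn
    · simp [hG, show m ≠ 0 by omega]
    · simp only [hG, h n hn, Finset.mul_sum]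
      refine Finset.sum_congr rfl fun p hp ↦ ?_
      have hp' := Nat.mem_divisorsAntidiagonal.1 hp
      have : (p.1 : ℂ) ≠ 0 := by
        intro h0
        have : p.1 = 0 := by exact_mod_cast h0
        rw [← hp'.1, this, zero_mul] at hn
        exact hn rfl
      simp only [hF, ← hp'.1, X]
      push_cast
      field_simp
      ring
  have hinv : ∀ n ≠ 0, (M ⍟ G) n = F n := by
    intro n hn
    have h1 : toArithmeticFunction X * toArithmeticFunction M = 1 := by
      apply DFunLike.coe_injective
      change X ⍟ M = _
      rw [DirichletCharacter.convolution_mul_moebius χ]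
      exact ArithmeticFunction.one_eq_delta.symm
    rw [hconv, LSeries.convolution, LSeries.convolution,
      ArithmeticFunction.toArithmeticFunction_eq_self, ← mul_assoc, mul_comm (toArithmeticFunction M),
      h1, one_mul]
    change (if n = 0 then 0 else F n) = F n
    rw [if_neg hn]
  have hFs : LSeriesSummable F m :=
    (LSeriesSummable_congr _ (fun {n} hn ↦ hinv n hn)).1 (hMs.convolution hGs.LSeriesSummable)
  have hFsum : HasSum (fun n : ℕ+ ↦ f n) (LSeries F m) := (hpn f _).2 hFs.LSeriesHasSum
  refine ⟨hFsum.summable, ?_⟩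
  rw [hFsum.tsum_eq, ← LSeries_convolution' hXs hFs, ← hconv, hGs.LSeries_eq]

lemma tendsto_sigmaSeries_aux (k : ℕ) :
    Tendsto (fun q : ℂ ↦ ∑' n : ℕ+, (ArithmeticFunction.sigma k n : ℂ) * q ^ ((n : ℕ) - 1)) (𝓝 0)
      (𝓝 1) := by
  have hb : Summable fun n : ℕ+ ↦ ((n : ℕ) : ℝ) ^ (k + 1) * (1 / 2) ^ ((n : ℕ) - 1) := by
    have : Summable fun n : ℕ ↦ (n : ℝ) ^ (k + 1) * (1 / 2) ^ n :=
      summable_pow_mul_geometric_of_norm_lt_one (k + 1) (by norm_num)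
    refine ((this.comp_injective PNat.coe_injective).mul_left 2).congr fun n ↦ ?_
    have : (1 / 2 : ℝ) ^ (n : ℕ) = (1 / 2) ^ ((n : ℕ) - 1) * (1 / 2) := by
      rw [← pow_succ, Nat.sub_add_cancel n.pos]
    simp only [Function.comp_apply, this]
    ring
  have hlim := tendsto_tsum_of_dominated_convergence (𝓕 := 𝓝 (0 : ℂ))
    (f := fun (q : ℂ) (n : ℕ+) ↦ (ArithmeticFunction.sigma k n : ℂ) * q ^ ((n : ℕ) - 1))
    (g := fun n : ℕ+ ↦ if n = 1 then 1 else 0) hb ?_ ?_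
  · simpa using hlim
  · intro n
    have hc : Continuous fun q : ℂ ↦ (ArithmeticFunction.sigma k n : ℂ) * q ^ ((n : ℕ) - 1) := by
      fun_prop
    refine (hc.tendsto 0).mono_right (le_of_eq ?_)
    congr 1
    split_ifs with h
    · subst h; simp
    · have : (n : ℕ) - 1 ≠ 0 := by
        have : (n : ℕ) ≠ 1 := fun h' ↦ h (PNat.eq h')
        have := n.pos
        omega
      simp [this]
  · filter_upwards [Metric.ball_mem_nhds (0 : ℂ) (by norm_num : (0 : ℝ) < 1 / 2)] with q hq n
    rw [mem_ball_zero_iff] at hq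
    rw [norm_mul, norm_pow, Complex.norm_natCast]
    gcongr
    exact_mod_cast ArithmeticFunction.sigma_le_pow_succ k n

lemma dirichletCharacter_two_of_even {n : ℕ} (h : Even n) :
    (1 : DirichletCharacter ℂ 2) (n : ZMod 2) = 0 := by
  refine MulChar.map_nonunit _ ?_
  rw [ZMod.isUnit_iff_coprime, Nat.coprime_two_right]
  simpa using h

lemma dirichletCharacter_two_of_odd {n : ℕ} (h : Odd n) :
    (1 : DirichletCharacter ℂ 2) (n : ZMod 2) = 1 := by
  refine MulChar.one_apply ?_
  rwa [ZMod.isUnit_iff_coprime, Nat.coprime_two_right]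

/-- Since c and d are not both even, their gcd n is odd, which is what χ₀ records. Dividing by an
odd n preserves parities and leaves a coprime pair. -/
lemma tsum_gcd_eq (m : ℕ) {a b : ℤ} (hab : ¬ (a ≡ 0 [ZMOD 2] ∧ b ≡ 0 [ZMOD 2])) (z : ℂ)
    {c n e : ℕ} (hc : c ≠ 0) (hn : n * e = c) :
    ∑' d : ℤ, (if ((c : ℤ) ≡ a [ZMOD 2] ∧ d ≡ b [ZMOD 2]) ∧ Int.gcd c d = n then
      1 / (((c : ℤ) : ℂ) * z + d) ^ m else 0) =
    (1 : DirichletCharacter ℂ 2) (n : ZMod 2) * ((n : ℂ) ^ m)⁻¹ * rowCoprime m a b z e := by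
  have hn0 : n ≠ 0 := by rintro rfl; simp at hn; exact hc hn.symm
  rcases Nat.even_or_odd n with h | h
  · rw [dirichletCharacter_two_of_even h, zero_mul, zero_mul]
    convert tsum_zero with d
    rw [if_neg]
    rintro ⟨⟨h1, h2⟩, h3⟩
    have h4 : (2 : ℤ) ∣ Int.gcd c d := by rw [h3]; exact_mod_cast h.two_dvd
    have h5 := h4.trans (Int.gcd_dvd_left _ _)
    have h6 := h4.trans (Int.gcd_dvd_right _ _)
    exact hab ⟨h1.symm.trans (Int.modEq_zero_iff_dvd.2 h5),
      h2.symm.trans (Int.modEq_zero_iff_dvd.2 h6)⟩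
  · rw [dirichletCharacter_two_of_odd h, one_mul]
    have hinj : Function.Injective (fun d : ℤ ↦ (n : ℤ) * d) := fun x y hxy ↦ by
      simpa [hn0] using hxy
    have hmod : ∀ x y : ℤ, (n : ℤ) * x ≡ y [ZMOD 2] ↔ x ≡ y [ZMOD 2] := fun x y ↦ by
      have h1 : (n : ℤ) ≡ 1 [ZMOD 2] := by
        obtain ⟨j, rfl⟩ := h
        simp only [Int.ModEq]; push_cast; omega
      have h2 := h1.mul_right x
      rw [one_mul] at h2
      exact ⟨fun h3 ↦ h2.symm.trans h3, fun h3 ↦ h2.trans h3⟩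
    rw [← hinj.tsum_eq, rowCoprime, ← tsum_mul_left]
    · refine tsum_congr fun d ↦ ?_
      have hgcd : Int.gcd ((c : ℕ) : ℤ) (n * d) = n ↔ IsCoprime (e : ℤ) d := by
        rw [← hn, Int.isCoprime_iff_gcd_eq_one]
        push_cast
        rw [Int.gcd_mul_left, Int.natAbs_natCast]
        exact ⟨fun h' ↦ by simpa [hn0] using h', fun h' ↦ by rw [h', mul_one]⟩
      have hcm : (c : ℤ) ≡ a [ZMOD 2] ↔ (e : ℤ) ≡ a [ZMOD 2] := by
        rw [← hn]; push_cast; exact hmod _ _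
      simp only [hgcd, hcm, hmod, and_assoc]
      split_ifs
      · rw [one_div, one_div, ← mul_inv, ← mul_pow, ← hn]
        push_cast
        congr 2
        ring
      · simp
    · intro d hd
      have h3 : Int.gcd c d = n := by
        by_contra h3
        simp [h3] at hd
      have : (n : ℤ) ∣ d := h3 ▸ Int.gcd_dvd_right _ _
      obtain ⟨f, rfl⟩ := this
      exact ⟨f, rfl⟩

lemma row_eq_sum {m : ℕ} (hm : 2 ≤ m) {a b : ℤ} (hab : ¬ (a ≡ 0 [ZMOD 2] ∧ b ≡ 0 [ZMOD 2])) (z : ℂ)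
    (c : ℕ) (hc : c ≠ 0) :
    row m a b z c = ∑ p ∈ c.divisorsAntidiagonal,
      (1 : DirichletCharacter ℂ 2) (p.1 : ZMod 2) * ((p.1 : ℂ) ^ m)⁻¹ * rowCoprime m a b z p.2 := by
  have h1 : ∀ p ∈ c.divisorsAntidiagonal, (1 : DirichletCharacter ℂ 2) (p.1 : ZMod 2) *
      ((p.1 : ℂ) ^ m)⁻¹ * rowCoprime m a b z p.2 = ∑' d : ℤ, (if ((c : ℤ) ≡ a [ZMOD 2] ∧
        d ≡ b [ZMOD 2]) ∧ Int.gcd c d = p.1 then 1 / (((c : ℤ) : ℂ) * z + d) ^ m else 0) :=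
    fun p hp ↦ (tsum_gcd_eq m hab z hc (Nat.mem_divisorsAntidiagonal.1 hp).1).symm
  rw [Finset.sum_congr rfl h1, ← Summable.tsum_finsetSum fun p _ ↦ summable_ite_linear hm z c _, row]
  refine tsum_congr fun d ↦ ?_
  rw [Nat.sum_divisorsAntidiagonal (fun i _ ↦ if ((c : ℤ) ≡ a [ZMOD 2] ∧
        d ≡ b [ZMOD 2]) ∧ Int.gcd c d = i then 1 / (((c : ℤ) : ℂ) * z + d) ^ m else 0)]
  have hmem : Int.gcd c d ∈ c.divisors := by
    rw [Nat.mem_divisors]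
    exact ⟨by exact_mod_cast Int.gcd_dvd_left (c : ℤ) d, hc⟩
  simp only [ite_and]
  split_ifs <;> simp [hmem]

/-- Rows c and −c agree because m is even. Möbius inversion makes the outer sum summable also for m
= 2, where the double series is not absolutely convergent. -/
lemma S_eq_of_hasSum_row {m : ℕ} (hm : 2 ≤ m) (hme : Even m) {a b : ℤ}
    (hab : ¬ (a ≡ 0 [ZMOD 2] ∧ b ≡ 0 [ZMOD 2])) {z s : ℂ}
    (h : HasSum (fun n : ℕ+ ↦ row m a b z ((n : ℕ) : ℤ)) s) :
    S m a b z = rowCoprime m a b z 0 +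
      2 * ((LSeries (fun n : ℕ ↦ (1 : DirichletCharacter ℂ 2) (n : ZMod 2)) m)⁻¹ * s) := by
  obtain ⟨h1, h2⟩ := hasSum_of_eq_convolution (1 : DirichletCharacter ℂ 2) hm
    (f := fun n ↦ rowCoprime m a b z n) (g := fun n ↦ row m a b z n) (row_eq_sum hm hab z) h
  have hL : LSeries (fun n : ℕ ↦ (1 : DirichletCharacter ℂ 2) (n : ZMod 2)) m ≠ 0 :=
    DirichletCharacter.LSeries_ne_zero_of_one_lt_re 1 (by
      rw [Complex.natCast_re]; exact_mod_cast hm)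
  have heven := rowCoprime_even hme a b z
  have hsum : Summable (rowCoprime m a b z) := by
    refine Summable.of_nat_of_neg ?_ ?_
    · rwa [← summable_pnat_iff_summable_nat]
    · simp only [heven _]
      rwa [← summable_pnat_iff_summable_nat]
  have h3 : S m a b z = ∑' c : ℤ, rowCoprime m a b z c := rfl
  rw [h3, tsum_int_eq_zero_add_two_mul_tsum_pnat heven hsum, ← h2, inv_mul_cancel_left₀ hL,
    nsmul_eq_mul]
  norm_num

lemma E_eq {k : ℕ} (hk : 1 ≤ k) (ε : ℤˣ) {z : ℂ} (hz : 0 < z.im) :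
    E k ε z = 1 + (Lval k)⁻¹ * (lipschitzConst (2 * k) *
      (sigmaSeries (2 * k - 1) (cexp (2 * π * Complex.I * (2 * z))) -
        ((2 : ℂ) ^ (2 * k))⁻¹ * sigmaSeries (2 * k - 1) (cexp (2 * π * Complex.I * z)) +
        ((ε : ℤ) : ℂ) * (((2 : ℂ) ^ (2 * k))⁻¹ *
          (sigmaSeries (2 * k - 1) (cexp (2 * π * Complex.I * (z / 2))) -
            sigmaSeries (2 * k - 1) (cexp (2 * π * Complex.I * z)))))) := by
  have hm : 2 ≤ 2 * k := by omega
  have he : Even (2 * k) := even_two_mul k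
  rw [E, S_eq_of_hasSum_row hm he (by decide) (hasSum_row_zero_one hm hz),
    S_eq_of_hasSum_row hm he (by decide) (hasSum_row_one_zero hm hz), rowCoprime_zero he,
    rowCoprime_zero', Lval]
  push_cast
  ring

lemma tendsto_sigmaSeries_div (k : ℕ) :
    Tendsto (fun q : ℂ ↦ sigmaSeries k q / q) (𝓝[≠] 0) (𝓝 1) := by
  refine ((tendsto_sigmaSeries_aux k).mono_left nhdsWithin_le_nhds).congr' ?_
  filter_upwards [self_mem_nhdsWithin] with q hq
  rw [sigmaSeries, ← tsum_div_const]
  refine tsum_congr fun n ↦ ?_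
  have : q ^ (n : ℕ) = q ^ ((n : ℕ) - 1) * q := by rw [← pow_succ, Nat.sub_add_cancel n.pos]
  rw [this]
  field_simp [show q ≠ 0 from hq]

/-! ### Modularity for k ≥ 2. -/

section AbsolutelyConvergent

lemma S_eq_eisensteinSeries {m : ℕ} (hm : 3 ≤ m) (a b : ℤ) (τ : ℍ) :
    S m a b τ = eisensteinSeries (N := 2) ![(a : ZMod 2), (b : ZMod 2)] (m : ℤ) τ := by
  classical
  set A := EisensteinSeries.gammaSet 2 1 ![(a : ZMod 2), (b : ZMod 2)]
  have hs : Summable (A.indicator fun x ↦ EisensteinSeries.eisSummand (m : ℤ) x τ) :=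
    (summable_eisSummand hm τ).indicator _
  rw [eisensteinSeries, tsum_subtype A (fun x ↦ EisensteinSeries.eisSummand (m : ℤ) x τ),
    ← (finTwoArrowEquiv ℤ).symm.tsum_eq, Summable.tsum_prod, S]
  · refine tsum_congr fun c ↦ tsum_congr fun d ↦ ?_
    have hmem : (finTwoArrowEquiv ℤ).symm (c, d) ∈ A ↔
        c ≡ a [ZMOD 2] ∧ d ≡ b [ZMOD 2] ∧ IsCoprime c d := by
      simp only [A, EisensteinSeries.gammaSet, Set.mem_ofPred_eq, funext_iff, Fin.forall_fin_two]
      simp only [Int.isCoprime_iff_gcd_eq_one, ← and_assoc]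
      exact and_congr (and_congr (ZMod.intCast_eq_intCast_iff c a 2)
        (ZMod.intCast_eq_intCast_iff d b 2)) Iff.rfl
    rw [Set.indicator_apply]
    simp only [hmem]
    refine if_congr Iff.rfl ?_ rfl
    simp [EisensteinSeries.eisSummand]
  · exact (finTwoArrowEquiv ℤ).symm.summable_iff.2 hs

lemma isMF_S {k : ℕ} (hk : 2 ≤ k) (a b : ℤ) : IsMF (k * 2) (fun τ : ℍ ↦ S (2 * k) a b τ) := by
  have hm : 3 ≤ 2 * k := by omega
  have h := isMF_of_modularForm (ModularForm.eisensteinSeriesMF (k := (k : ℤ) * 2) (N := 2)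
    (by omega) ![(a : ZMod 2), (b : ZMod 2)])
  convert h using 1
  funext τ
  rw [S_eq_eisensteinSeries hm]
  push_cast
  rw [mul_comm]
  rfl

lemma S_slash_S {k : ℕ} (hk : 2 ≤ k) (a b : ℤ) :
    (fun τ : ℍ ↦ S (2 * k) a b τ) ∣[(k * 2 : ℤ)] ModularGroup.S =
      fun τ : ℍ ↦ S (2 * k) b a τ := by
  have hm : 3 ≤ 2 * k := by omega
  have hw : ((2 * k : ℕ) : ℤ) = k * 2 := by push_cast; ring
  have h : ∀ a b : ℤ, (fun τ : ℍ ↦ S (2 * k) a b τ) =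
      eisensteinSeries (N := 2) ![(a : ZMod 2), (b : ZMod 2)] (k * 2 : ℤ) := by
    intro a b
    funext τ
    rw [S_eq_eisensteinSeries hm, hw]
  rw [h, h, EisensteinSeries.eisensteinSeries_slash_apply]
  congr 1
  exact vecAct_S ![(a : ZMod 2), (b : ZMod 2)]

end AbsolutelyConvergent

/-! ### Modularity for k = 1 by means of G₂. -/

section WeightTwo

/-- The weight two Eisenstein series `G₂` as a function on `ℂ`. -/
noncomputable def G2C (z : ℂ) : ℂ := EisensteinSeries.G2 (ofComplex z)

lemma G2C_eq {z : ℂ} (hz : 0 < z.im) : G2C z = 2 * riemannZeta 2 +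
    2 * lipschitzConst 2 * sigmaSeries 1 (cexp (2 * π * Complex.I * z)) := by
  rw [G2C, ofComplex_apply_of_im_pos hz, EisensteinSeries.G2_eq_tsum_cexp, lipschitzConst, sigmaSeries]
  norm_num
  rw [mul_pow, mul_pow, Complex.I_sq]
  ring

lemma G2C_add_one {z : ℂ} (hz : 0 < z.im) : G2C (z + 1) = G2C z := by
  rw [G2C_eq hz, G2C_eq (by simpa using hz), mul_add, mul_one, Complex.exp_periodic]

lemma G2C_neg_inv {z : ℂ} (hz : 0 < z.im) :
    G2C (-1 / z) = z ^ 2 * G2C z - 2 * π * Complex.I * z := by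
  have h := EisensteinSeries.G2_S_transform ⟨z, hz⟩
  have hz0 : z ≠ 0 := fun h ↦ by simp [h] at hz
  have h1 : ofComplex (-1 / z) = ModularGroup.S • (⟨z, hz⟩ : ℍ) := by
    rw [← ofComplex_apply (ModularGroup.S • (⟨z, hz⟩ : ℍ)), coe_S_smul]
  rw [G2C, G2C, h1, ofComplex_apply_of_im_pos hz, h]
  field_simp
  ring

lemma neg_one_div_im_pos {z : ℂ} (hz : 0 < z.im) : 0 < (-1 / z).im := by
  have := (ModularGroup.S • (⟨z, hz⟩ : ℍ)).im_pos
  rwa [← UpperHalfPlane.coe_im, coe_S_smul] at this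

/-- With v = (z − 1)/2, the point (−1/z + 1)/2 is −1/(−1/v − 2). Two inversions and two translations
by 1 therefore relate it to v. -/
lemma G2C_half_slash {z : ℂ} (hz : 0 < z.im) :
    G2C ((-1 / z + 1) / 2) = z ^ 2 * G2C ((z + 1) / 2) - 4 * π * Complex.I * z := by
  have hz0 : z ≠ 0 := fun h ↦ by simp [h] at hz
  have hz1 : z - 1 ≠ 0 := fun h ↦ by
    have := congrArg Complex.im h
    simp at this
    exact hz.ne' this
  set v := (z - 1) / 2 with hv
  have hvi : 0 < v.im := by
    have : v.im = z.im / 2 := by simp [hv]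
    rw [this]; positivity
  have h1 := neg_one_div_im_pos hvi
  have hv0 : v ≠ 0 := div_ne_zero hz1 two_ne_zero
  have e1 : (-1 / z + 1) / 2 = -1 / (-z / v) := by rw [hv]; field_simp; ring
  have e2 : -z / v = -1 / v - 1 - 1 := by rw [hv]; field_simp; ring
  have e3 : (z + 1) / 2 = v + 1 := by rw [hv]; ring
  have h2 : 0 < (-1 / v - 1 : ℂ).im := by simpa using h1
  have h3 : 0 < (-z / v : ℂ).im := by rw [e2]; simpa using h1
  have h4 : G2C (-z / v) = G2C (-1 / v) := by
    rw [← G2C_add_one h3, e2, sub_add_cancel, ← G2C_add_one h2, sub_add_cancel]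
  have e4 : z = 2 * v + 1 := by rw [hv]; ring
  rw [e1, G2C_neg_inv h3, h4, G2C_neg_inv hvi, e3, G2C_add_one hvi]
  field_simp
  rw [e4]
  ring

lemma differentiableAt_G2C {z : ℂ} (hz : 0 < z.im) : DifferentiableAt ℂ G2C z := by
  have h : MDiff EisensteinSeries.G2 := by
    have h2 : EisensteinSeries.G2 = (2 * riemannZeta 2) • EisensteinSeries.E2 := by
      rw [EisensteinSeries.E2, smul_smul, mul_one_div_cancel, one_smul]
      exact mul_ne_zero two_ne_zero (riemannZeta_ne_zero_of_one_lt_re (by norm_num))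
    rw [h2]
    exact MDifferentiable.const_smul _ E2_mdifferentiable
  rw [UpperHalfPlane.mdifferentiable_iff] at h
  exact (h z hz).differentiableAt (isOpen_upperHalfPlaneSet.mem_nhds hz)

lemma differentiableAt_G2C_comp {f : ℂ → ℂ} {z : ℂ} (hf : DifferentiableAt ℂ f z)
    (hz : 0 < (f z).im) : DifferentiableAt ℂ (fun z ↦ G2C (f z)) z :=
  DifferentiableAt.comp (g := G2C) z (differentiableAt_G2C hz) hf

lemma tendsto_sigmaSeries (k : ℕ) : Tendsto (sigmaSeries k) (𝓝[≠] 0) (𝓝 0) := by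
  have h : Tendsto (fun q : ℂ ↦ q) (𝓝[≠] 0) (𝓝 0) := tendsto_id.mono_left nhdsWithin_le_nhds
  have h2 := (tendsto_sigmaSeries_div k).mul h
  rw [mul_zero] at h2
  refine h2.congr' ?_
  filter_upwards [self_mem_nhdsWithin] with q hq
  exact div_mul_cancel₀ _ hq

lemma tendsto_G2C {w : ℍ → ℂ} (hw : ∀ τ, 0 < (w τ).im)
    (h : Tendsto (fun τ ↦ cexp (2 * π * Complex.I * w τ)) atImInfty (𝓝 0)) :
    Tendsto (fun τ ↦ G2C (w τ)) atImInfty (𝓝 (2 * riemannZeta 2)) := by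
  have h2 : Tendsto (fun τ ↦ cexp (2 * π * Complex.I * w τ)) atImInfty (𝓝[≠] 0) :=
    tendsto_nhdsWithin_iff.2 ⟨h, Eventually.of_forall fun τ ↦ Complex.exp_ne_zero _⟩
  have h3 := (((tendsto_sigmaSeries 1).comp h2).const_mul (2 * lipschitzConst 2)).const_add
    (2 * riemannZeta 2)
  rw [mul_zero, add_zero] at h3
  exact h3.congr fun τ ↦ (G2C_eq (hw τ)).symm

/-- The three weight two Eisenstein series of level two, indexed by the nonzero vectors modulo `2`. -/
noncomputable def levelTwoG2 (a : Fin 2 → ZMod 2) (τ : ℍ) : ℂ :=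
  if a = ![0, 1] then 4 * G2C (2 * τ) else if a = ![1, 0] then G2C (τ / 2) else G2C ((τ + 1) / 2)

lemma levelTwoG2_zero_one : levelTwoG2 ![0, 1] = fun τ : ℍ ↦ 4 * G2C (2 * τ) := by
  funext τ; simp [levelTwoG2]

lemma levelTwoG2_one_zero : levelTwoG2 ![1, 0] = fun τ : ℍ ↦ G2C (τ / 2) := by
  funext τ; simp [levelTwoG2]

lemma levelTwoG2_one_one : levelTwoG2 ![1, 1] = fun τ : ℍ ↦ G2C ((τ + 1) / 2) := by
  funext τ; simp [levelTwoG2]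

/-- The factor 4 in the first series makes the defect −4πi/τ the same for all three. -/
lemma levelTwoG2_slash_S (a : Fin 2 → ZMod 2) (ha : a ≠ 0) :
    levelTwoG2 a ∣[(2 : ℤ)] ModularGroup.S = levelTwoG2 (vecAct a ModularGroup.S) +
      fun τ : ℍ ↦ -4 * π * Complex.I / τ := by
  rw [vecAct_S]
  ext τ
  have hτ := τ.im_pos
  have h0 : (τ : ℂ) ≠ 0 := τ.ne_zero
  rw [slash_S_apply, Pi.add_apply, zpow_neg]
  norm_cast
  rcases zmod_two_vec_cases a ha with rfl | rfl | rfl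
  · have e : (2 : ℂ) * (-1 / τ) = -1 / (τ / 2) := by field_simp
    have h2 : 0 < ((τ : ℂ) / 2).im := by simpa using hτ
    simp only [Matrix.cons_val_zero, Matrix.cons_val_one, levelTwoG2_zero_one, levelTwoG2_one_zero,
      coe_S_smul]
    rw [e, G2C_neg_inv h2]
    push_cast
    field_simp
    ring
  · have e : (-1 / τ : ℂ) / 2 = -1 / (2 * τ) := by field_simp
    have h2 : 0 < (2 * (τ : ℂ)).im := by simpa using hτ
    simp only [Matrix.cons_val_zero, Matrix.cons_val_one, levelTwoG2_zero_one, levelTwoG2_one_zero,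
      coe_S_smul]
    rw [e, G2C_neg_inv h2]
    push_cast
    field_simp
    ring
  · simp only [Matrix.cons_val_zero, Matrix.cons_val_one, levelTwoG2_one_one, coe_S_smul]
    rw [G2C_half_slash (z := τ) hτ]
    push_cast
    field_simp
    ring

lemma levelTwoG2_slash_T (a : Fin 2 → ZMod 2) (ha : a ≠ 0) :
    levelTwoG2 a ∣[(2 : ℤ)] ModularGroup.T = levelTwoG2 (vecAct a ModularGroup.T) + 0 := by
  rw [vecAct_T, add_zero]
  ext τ
  have hτ := τ.im_pos
  rw [slash_T_apply]
  rcases zmod_two_vec_cases a ha with rfl | rfl | rfl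
  · have h2 : 0 < (2 * (τ : ℂ)).im := by simpa using hτ
    have h3 : 0 < (2 * (τ : ℂ) + 1).im := by simpa using hτ
    simp only [Matrix.cons_val_zero, Matrix.cons_val_one, zero_add, levelTwoG2_zero_one, coe_T_smul]
    rw [← G2C_add_one h2, ← G2C_add_one h3]
    congr 2
    ring
  · simp only [Matrix.cons_val_zero, Matrix.cons_val_one, add_zero, levelTwoG2_one_zero,
      levelTwoG2_one_one, coe_T_smul]
  · have h2 : 0 < ((τ : ℂ) / 2).im := by simpa using hτ
    have e : (1 : ZMod 2) + 1 = 0 := by decide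
    simp only [Matrix.cons_val_zero, Matrix.cons_val_one, e, levelTwoG2_one_zero,
      levelTwoG2_one_one, coe_T_smul]
    rw [← G2C_add_one h2]
    congr 1
    ring

lemma levelTwoG2_mdiff (a : Fin 2 → ZMod 2) (ha : a ≠ 0) : MDiff (levelTwoG2 a) := by
  rcases zmod_two_vec_cases a ha with rfl | rfl | rfl
  · rw [levelTwoG2_zero_one]
    refine mdifferentiable_of_differentiableAt (fun z ↦ 4 * G2C (2 * z)) (fun _ ↦ rfl) fun z hz ↦ ?_
    exact (differentiableAt_G2C_comp (f := fun z ↦ 2 * z) (by fun_prop) (by simpa using hz)).const_mul 4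
  · rw [levelTwoG2_one_zero]
    refine mdifferentiable_of_differentiableAt (fun z ↦ G2C (z / 2)) (fun _ ↦ rfl) fun z hz ↦ ?_
    exact differentiableAt_G2C_comp (f := fun z ↦ z / 2) (by fun_prop) (by simpa using hz)
  · rw [levelTwoG2_one_one]
    refine mdifferentiable_of_differentiableAt (fun z ↦ G2C ((z + 1) / 2)) (fun _ ↦ rfl)
      fun z hz ↦ ?_
    exact differentiableAt_G2C_comp (f := fun z ↦ (z + 1) / 2) (by fun_prop) (by simpa using hz)

lemma levelTwoG2_bdd (a : Fin 2 → ZMod 2) (ha : a ≠ 0) : IsBoundedAtImInfty (levelTwoG2 a) := by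
  rcases zmod_two_vec_cases a ha with rfl | rfl | rfl
  · rw [levelTwoG2_zero_one]
    refine isBoundedAtImInfty_of_tendsto ((tendsto_G2C (fun τ ↦ by simpa using τ.im_pos)
      ((tendsto_cexp_atImInfty (e := 4) (by norm_num)).congr fun τ ↦ ?_)).const_mul 4)
    congr 1; push_cast; ring
  · rw [levelTwoG2_one_zero]
    refine isBoundedAtImInfty_of_tendsto (tendsto_G2C (fun τ ↦ by simpa using τ.im_pos)
      ((tendsto_cexp_atImInfty (e := 1) (by norm_num)).congr fun τ ↦ ?_))
    congr 1; push_cast; ring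
  · rw [levelTwoG2_one_one]
    have h := (tendsto_cexp_atImInfty (e := 1) (by norm_num)).mul_const (cexp (π * Complex.I))
    rw [zero_mul] at h
    refine isBoundedAtImInfty_of_tendsto (tendsto_G2C (fun τ ↦ by simpa using τ.im_pos)
      (h.congr fun τ ↦ ?_))
    rw [← Complex.exp_add]
    congr 1; push_cast; ring

lemma isMF_levelTwoG2_sub {a b : Fin 2 → ZMod 2} (ha : a ≠ 0) (hb : b ≠ 0) :
    IsMF 2 (levelTwoG2 a - levelTwoG2 b) :=
  isMF_sub_of_generators levelTwoG2_slash_S levelTwoG2_slash_T levelTwoG2_mdiff levelTwoG2_bdd ha hb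

lemma Lval_ne_zero {k : ℕ} (hk : 1 ≤ k) : Lval k ≠ 0 :=
  DirichletCharacter.LSeries_ne_zero_of_one_lt_re 1 (by
    have : (1 : ℝ) ≤ k := by exact_mod_cast hk
    simp
    linarith)

/-- The Euler factor at 2 is 1 − 2^(−2). -/
lemma Lval_one : Lval 1 = 3 / 4 * riemannZeta 2 := by
  have h := DirichletCharacter.LFunctionTrivChar_eq_mul_riemannZeta (N := 2) (s := 2) (by norm_num)
  rw [DirichletCharacter.LFunctionTrivChar, DirichletCharacter.LFunction_eq_LSeries _ (by norm_num)]
    at h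
  rw [Lval, Nat.cast_one, mul_one, h, Nat.Prime.primeFactors Nat.prime_two, Finset.prod_singleton]
  congr 1
  norm_num [Complex.cpow_neg]

/-- The Fourier expansions agree; the constant terms match because ζ(2) = (4/3) L(2, χ₀). -/
lemma E_one_eq : (fun τ : ℍ ↦ E 1 (-1) τ) =
    (1 / (8 * Lval 1)) • (levelTwoG2 ![0, 1] - levelTwoG2 ![1, 0]) := by
  ext τ
  have hτ : 0 < (τ : ℂ).im := τ.im_pos
  have h2 : 0 < (2 * (τ : ℂ)).im := by simpa using hτ
  have h3 : 0 < ((τ : ℂ) / 2).im := by simpa using hτ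
  rw [E_eq le_rfl _ hτ, levelTwoG2_zero_one, levelTwoG2_one_zero]
  simp only [Pi.smul_apply, Pi.sub_apply, smul_eq_mul, G2C_eq h2, G2C_eq h3]
  have hL := Lval_ne_zero le_rfl
  have hz : riemannZeta 2 = 4 / 3 * Lval 1 := by rw [Lval_one]; ring
  rw [hz]
  push_cast
  field_simp
  ring

end WeightTwo

/-! ### E as a form for Γ(2): action of S and first Fourier coefficient. -/

section MainForm

variable {k : ℕ} {ε : ℤˣ}

lemma units_sq_cast (ε : ℤˣ) : ((ε : ℤ) : ℂ) * ((ε : ℤ) : ℂ) = 1 := by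
  rcases Int.units_eq_one_or ε with rfl | rfl <;> simp

lemma E_eq_smul (k : ℕ) (ε : ℤˣ) : (fun τ : ℍ ↦ E k ε τ) = (1 / 2 : ℂ) •
    ((fun τ : ℍ ↦ S (2 * k) 0 1 τ) + ((ε : ℤ) : ℂ) • fun τ : ℍ ↦ S (2 * k) 1 0 τ) := by
  ext τ; simp [E]

lemma one_lt_or_weight_two (hk : 1 ≤ k) (hε : ε = 1 → 2 ≤ k) : 2 ≤ k ∨ k = 1 ∧ ε = -1 := by
  rcases Int.units_eq_one_or ε with h | h
  · exact Or.inl (hε h)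
  · by_cases h2 : 2 ≤ k
    · exact Or.inl h2
    · exact Or.inr ⟨by omega, h⟩

lemma isMF_E (hk : 1 ≤ k) (hε : ε = 1 → 2 ≤ k) : IsMF (k * 2) (fun τ : ℍ ↦ E k ε τ) := by
  rcases one_lt_or_weight_two hk hε with h | ⟨rfl, rfl⟩
  · have := ((isMF_S h 0 1).sub ((isMF_S h 1 0).smul (-((ε : ℤ) : ℂ)))).smul (1 / 2)
    rw [E_eq_smul]
    convert this using 2
    ext τ
    simp
  · rw [E_one_eq]
    have := (isMF_levelTwoG2_sub (a := ![0, 1]) (b := ![1, 0]) (by decide) (by decide)).smul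
      (1 / (8 * Lval 1))
    simpa using this

/-- S exchanges the classes (0, 1) and (1, 0). In weight two their common defect cancels because ε =
−1. -/
lemma E_slash_S (hk : 1 ≤ k) (hε : ε = 1 → 2 ≤ k) :
    (fun τ : ℍ ↦ E k ε τ) ∣[(k * 2 : ℤ)] ModularGroup.S =
      ((ε : ℤ) : ℂ) • fun τ : ℍ ↦ E k ε τ := by
  rcases one_lt_or_weight_two hk hε with h | ⟨rfl, rfl⟩
  · rw [E_eq_smul, SL_smul_slash, SlashAction.add_slash, SL_smul_slash, S_slash_S h, S_slash_S h]
    ext τ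
    simp only [Pi.smul_apply, Pi.add_apply, smul_eq_mul]
    linear_combination (-1 / 2 * S (2 * k) 1 0 τ) * units_sq_cast ε
  · rw [E_one_eq, SL_smul_slash, slash_sub]
    have h1 := levelTwoG2_slash_S ![0, 1] (by decide)
    have h2 := levelTwoG2_slash_S ![1, 0] (by decide)
    rw [vecAct_S] at h1 h2
    simp only [Matrix.cons_val_zero, Matrix.cons_val_one] at h1 h2
    simp only [Nat.cast_one, one_mul, h1, h2]
    ext τ
    simp
    ring

/-- Only the divisor series at τ/2 starts at order `qh`; those at τ and 2τ start at `qh`² and `qh`⁴.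
-/
lemma tendsto_E_sub_one_div_qh (hk : 1 ≤ k) :
    Tendsto (fun τ : ℍ ↦ (E k ε τ - 1) / qh τ) atImInfty (𝓝 (((ε : ℤ) : ℂ) *
      ((2 * (Real.pi : ℂ) * Complex.I) ^ (2 * k) /
        (4 ^ k * Complex.Gamma (2 * (k : ℂ)) * Lval k)))) := by
  set s := sigmaSeries (2 * k - 1) with hs
  have hq : Tendsto qh atImInfty (𝓝[≠] 0) :=
    tendsto_nhdsWithin_iff.2 ⟨tendsto_qh, Eventually.of_forall qh_ne_zero⟩
  have hp : ∀ n : ℕ, n ≠ 0 → Tendsto (fun τ ↦ s (qh τ ^ (n + 1)) / qh τ) atImInfty (𝓝 0) := by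
    intro n hn
    have h1 : Tendsto (fun τ ↦ qh τ ^ (n + 1)) atImInfty (𝓝[≠] 0) := by
      refine tendsto_nhdsWithin_iff.2 ⟨?_, Eventually.of_forall fun τ ↦
        pow_ne_zero _ (qh_ne_zero τ)⟩
      simpa using tendsto_qh.pow (n + 1)
    have h2 := ((tendsto_sigmaSeries_div (2 * k - 1)).comp h1).mul (tendsto_qh.pow n)
    rw [zero_pow hn, mul_zero] at h2
    refine h2.congr fun τ ↦ ?_
    have := qh_ne_zero τ
    simp only [Function.comp_apply, ← hs]
    rw [pow_succ]
    field_simp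
  have h1 := (tendsto_sigmaSeries_div (2 * k - 1)).comp hq
  have h2 := hp 1 one_ne_zero
  have h4 := hp 3 three_ne_zero
  have hlim := ((h4.sub (h2.const_mul ((2 : ℂ) ^ (2 * k))⁻¹)).add
    ((h1.sub h2).const_mul (((ε : ℤ) : ℂ) * ((2 : ℂ) ^ (2 * k))⁻¹))).const_mul
    ((Lval k)⁻¹ * lipschitzConst (2 * k))
  convert hlim.congr fun τ ↦ ?_ using 2
  · have hG : Complex.Gamma (2 * (k : ℂ)) = (Nat.factorial (2 * k - 1) : ℂ) := by
      rw [← Complex.Gamma_nat_eq_factorial]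
      congr 1
      have : 1 ≤ 2 * k := by omega
      push_cast [this]
      ring
    have h4k : (2 : ℂ) ^ (2 * k) = 4 ^ k := by rw [pow_mul]; norm_num
    rw [hG, lipschitzConst, h4k, show (-2 * π * Complex.I : ℂ) = -(2 * π * Complex.I) by ring,
      (even_two_mul k).neg_pow]
    field_simp
    ring
  · have hτ : 0 < (τ : ℂ).im := τ.im_pos
    have e1 : cexp (2 * π * Complex.I * (τ / 2)) = qh τ := by rw [qh]; congr 1; ring
    have e2 : cexp (2 * π * Complex.I * τ) = qh τ ^ (1 + 1) := by
      rw [qh, ← Complex.exp_nat_mul]; congr 1; push_cast; ring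
    have e4 : cexp (2 * π * Complex.I * (2 * τ)) = qh τ ^ (3 + 1) := by
      rw [qh, ← Complex.exp_nat_mul]; congr 1; push_cast; ring
    rw [E_eq hk ε hτ, e1, e2, e4, ← hs]
    simp only [Function.comp_apply]
    ring

lemma tendsto_E (hk : 1 ≤ k) : Tendsto (fun τ : ℍ ↦ E k ε τ) atImInfty (𝓝 1) := by
  have h := ((tendsto_E_sub_one_div_qh (ε := ε) hk).mul tendsto_qh).const_add 1
  rw [mul_zero, add_zero] at h
  refine h.congr fun τ ↦ ?_
  rw [div_mul_cancel₀ _ (qh_ne_zero τ)]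
  ring

end MainForm

/-! ### Orders of vanishing as root multiplicities; invariance of λ. -/

open Polynomial in
lemma analyticOrderAt_polynomial {P : ℂ[X]} (hP : P ≠ 0) (w : ℂ) :
    analyticOrderAt (fun z ↦ P.eval z) w = P.rootMultiplicity w := by
  obtain ⟨Q, hQ, hQw⟩ := P.exists_eq_pow_rootMultiplicity_mul_and_not_dvd hP w
  rw [AnalyticAt.analyticOrderAt_eq_natCast (AnalyticAt.aeval_polynomial analyticAt_id P)]
  refine ⟨fun z ↦ Q.eval z, AnalyticAt.aeval_polynomial analyticAt_id Q, fun h ↦ hQw ?_,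
    Eventually.of_forall fun z ↦ ?_⟩
  · exact Polynomial.dvd_iff_isRoot.2 h
  · conv_lhs => rw [hQ]
    simp

lemma analyticAt_of_differentiableAt {f : ℂ → ℂ}
    (h : ∀ z : ℂ, 0 < z.im → DifferentiableAt ℂ f z) (τ : ℍ) : AnalyticAt ℂ f τ :=
  DifferentiableOn.analyticAt (fun z hz ↦ (h z hz).differentiableWithinAt)
    (isOpen_upperHalfPlaneSet.mem_nhds τ.im_pos)

-- The power of Θ₃ is a unit and λ is a local coordinate at τ, so the order of f is that of P at
-- λ(τ).
open Polynomial in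
lemma analyticOrderAt_eq_rootMultiplicity {f : ℂ → ℂ} {P : ℂ[X]} (hP : P ≠ 0) (n : ℕ)
    (h : ∀ τ : ℍ, f τ = thY τ ^ n * P.eval (lam τ)) (τ : ℍ) :
    analyticOrderAt f τ = P.rootMultiplicity (lam τ) := by
  have hY : AnalyticAt ℂ (fun z ↦ (jacobiTheta z ^ 4) ^ n) τ :=
    ((analyticAt_of_differentiableAt (fun z hz ↦ differentiableAt_jacobiTheta hz) τ).pow 4).pow n
  have hlam : AnalyticAt ℂ lam τ :=
    analyticAt_of_differentiableAt (fun z hz ↦ (hasDerivAt_lam ⟨z, hz⟩).differentiableAt) τ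
  have hPa : AnalyticAt ℂ (fun z ↦ P.eval z) (lam τ) := AnalyticAt.aeval_polynomial analyticAt_id P
  have heq : f =ᶠ[𝓝 (τ : ℂ)] (fun z ↦ (jacobiTheta z ^ 4) ^ n) * ((fun z ↦ P.eval z) ∘ lam) := by
    filter_upwards [isOpen_upperHalfPlaneSet.mem_nhds τ.im_pos] with z hz
    exact h ⟨z, hz⟩
  rw [analyticOrderAt_congr heq, analyticOrderAt_mul hY (hPa.comp hlam),
    hY.analyticOrderAt_eq_zero.2 (pow_ne_zero n (thY_ne_zero τ)), zero_add,
    analyticOrderAt_comp_of_deriv_ne_zero hlam (deriv_lam_ne_zero τ), analyticOrderAt_polynomial hP]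

lemma lam_smul_of_mem_Gamma {γ : SL(2, ℤ)} (hγ : γ ∈ CongruenceSubgroup.Gamma 2) (τ : ℍ) :
    lam (γ • τ : ℍ) = lam τ := by
  have hX := congrFun (thX_isMF.slash_eq γ hγ) τ
  have hY := congrFun (thY_isMF.slash_eq γ hγ) τ
  rw [SL_slash_apply] at hX hY
  have h0 := zpow_ne_zero (-2) (UpperHalfPlane.denom_ne_zero γ τ)
  rw [lam_eq_thX_div_thY, lam_eq_thX_div_thY, ← hX, ← hY, mul_div_mul_right _ _ h0]

lemma lam_S_smul (τ : ℍ) : lam (ModularGroup.S • τ : ℍ) = 1 - lam τ := by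
  have hX := congrFun thX_slash_S τ
  have hY := congrFun thY_slash_S τ
  rw [slash_S_apply] at hX hY
  have h0 := zpow_ne_zero (-2) τ.ne_zero
  rw [one_sub_lam, lam_eq_thX_div_thY, ← mul_div_mul_right _ _ h0, hX, hY, Pi.neg_apply,
    Pi.neg_apply, neg_div_neg_eq]

/-! ### Sums over Γ(2)-orbits. -/

section Representatives

variable {ρ : Orbits → ℍ} (hρ : ∀ x : Orbits, (Quotient.mk _ (ρ x) : Orbits) = x)
include hρ

lemma lam_comp_injective : Function.Injective fun x ↦ lam (ρ x) := by
  intro x y hxy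
  obtain ⟨γ, hγ, h⟩ := exists_smul_eq_of_lam_eq hxy
  rw [← hρ x, ← hρ y]
  exact Quotient.sound ⟨⟨γ, hγ⟩, h⟩

lemma mem_range_lam_comp {w : ℂ} (h0 : w ≠ 0) (h1 : w ≠ 1) : w ∈ Set.range fun x ↦ lam (ρ x) := by
  obtain ⟨τ, rfl⟩ := exists_lam_eq h0 h1
  refine ⟨Quotient.mk _ τ, ?_⟩
  obtain ⟨⟨γ, hγ⟩, h⟩ := Quotient.exact (hρ (Quotient.mk _ τ))
  simp only at h ⊢
  rw [← h]
  exact lam_smul_of_mem_Gamma hγ τ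

-- Since neither 0 nor 1 is a root, every root is λ of exactly one orbit. The support is finite, and
-- the sum is minus the logarithmic derivative of P at 0.
open Polynomial in
lemma finsum_rootMultiplicity {P : ℂ[X]} (h0 : P.eval 0 ≠ 0) (h1 : P.eval 1 ≠ 0) :
    ∑ᶠ x : Orbits, (P.rootMultiplicity (lam (ρ x)) : ℂ) * (1 / lam (ρ x)) =
      -(P.derivative.eval 0 / P.eval 0) := by
  classical
  set f : ℂ → ℂ := fun w ↦ (P.rootMultiplicity w : ℂ) * (1 / w) with hf
  have hsupp : Function.support f ⊆ P.roots.toFinset := by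
    intro w hw
    have : P.rootMultiplicity w ≠ 0 := fun h ↦ hw (by simp [hf, h])
    rw [← count_roots] at this
    simpa [Multiset.count_eq_zero, and_comm] using this
  have hrange : Function.support f ⊆ Set.range fun x ↦ lam (ρ x) := by
    intro w hw
    have : P.eval w = 0 := by
      have := hsupp hw
      simp only [Finset.mem_coe, Multiset.mem_toFinset] at this
      exact (mem_roots'.1 this).2
    exact mem_range_lam_comp hρ (by rintro rfl; exact h0 this) (by rintro rfl; exact h1 this)
  have h2 : ∑ᶠ x : Orbits, f (lam (ρ x)) = ∑ᶠ w, f w := by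
    rw [← finsum_mem_range (f := f) (lam_comp_injective hρ), finsum_mem_def]
    refine finsum_congr fun w ↦ ?_
    rw [Set.indicator_apply]
    split_ifs with hw
    · rfl
    · by_contra h
      exact hw (hrange fun h' ↦ h h'.symm)
  rw [h2, finsum_eq_sum_of_support_subset f hsupp,
    (IsAlgClosed.splits P).eval_derivative_div_eval_of_ne_zero h0,
    Finset.sum_multiset_map_count, ← Finset.sum_neg_distrib]
  refine Finset.sum_congr rfl fun w _ ↦ ?_
  rw [hf, count_roots, nsmul_eq_mul, zero_sub, div_neg, mul_neg, neg_neg]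

end Representatives

/-! ### The polynomial of E at 0 and 1. -/

section Values

open Polynomial

variable {k : ℕ} {ε : ℤˣ} {P : ℂ[X]} (hk : 1 ≤ k)
  (hP : ∀ τ : ℍ, E k ε τ = thY τ ^ k * P.eval (lam τ))
include hk hP

lemma eval_zero_eq_one : P.eval 0 = 1 := by
  have h1 := (tendsto_thY.pow k).mul ((P.continuous.tendsto 0).comp tendsto_lam)
  rw [one_pow, one_mul] at h1
  exact tendsto_nhds_unique (h1.congr fun τ ↦ (hP τ).symm) (tendsto_E hk)

/-- S maps λ to 1 − λ and E to εE, so (−1)^k P(1 − λ) = εP(λ). Letting λ → 0 gives (−1)^k P(1) = ε.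
-/
lemma eval_one_ne_zero (hε : ε = 1 → 2 ≤ k) : P.eval 1 ≠ 0 := by
  have hS : ∀ τ : ℍ, (-1) ^ k * P.eval (1 - lam τ) = ((ε : ℤ) : ℂ) * P.eval (lam τ) := by
    intro τ
    have h := congrFun (E_slash_S hk hε) τ
    have hY := congrFun thY_slash_S τ
    rw [slash_S_apply] at h hY
    simp only [Pi.smul_apply, smul_eq_mul, Pi.neg_apply] at h hY
    rw [hP, hP, lam_S_smul] at h
    have hz : (τ : ℂ) ^ (-(k * 2 : ℤ)) = ((τ : ℂ) ^ (-2 : ℤ)) ^ k := by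
      rw [← zpow_natCast, ← zpow_mul]
      congr 1
      ring
    rw [hz, mul_right_comm, ← mul_pow, hY, neg_pow] at h
    have h0 := pow_ne_zero k (thY_ne_zero τ)
    apply mul_left_cancel₀ h0
    linear_combination h
  have h1 : Tendsto (fun τ : ℍ ↦ 1 - lam τ) atImInfty (𝓝 1) := by
    simpa using tendsto_lam.const_sub 1
  have h2 := ((P.continuous.tendsto 1).comp h1).const_mul ((-1) ^ k)
  have h3 := ((P.continuous.tendsto 0).comp tendsto_lam).const_mul ((ε : ℤ) : ℂ)
  have h4 := tendsto_nhds_unique (h2.congr hS) h3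
  intro h
  rw [h, mul_zero, eval_zero_eq_one hk hP, mul_one] at h4
  have := units_sq_cast ε
  rw [← h4] at this
  simp at this

/-- Both sides are the coefficient of `qh` in E: Θ₃^(4k) contributes 8k, and P(λ) contributes
16P'(0). -/
lemma derivative_eval_zero :
    8 * (k : ℂ) + 16 * P.derivative.eval 0 = ((ε : ℤ) : ℂ) *
      ((2 * (Real.pi : ℂ) * Complex.I) ^ (2 * k) /
        (4 ^ k * Complex.Gamma (2 * (k : ℂ)) * Lval k)) := by
  have h0 := eval_zero_eq_one hk hP
  have hY : Tendsto (fun τ ↦ (thY τ ^ k - 1) / qh τ) atImInfty (𝓝 (8 * k)) := by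
    have h1 : Tendsto (fun τ ↦ ∑ i ∈ Finset.range k, thY τ ^ i) atImInfty
        (𝓝 (∑ i ∈ Finset.range k, 1 ^ i)) :=
      tendsto_finsetSum _ fun i _ ↦ tendsto_thY.pow i
    have h2 := tendsto_thY_sub_one_div_qh.mul h1
    simp only [one_pow, Finset.sum_const, Finset.card_range, nsmul_eq_mul, mul_one] at h2
    refine h2.congr fun τ ↦ ?_
    rw [← geom_sum_mul]
    ring
  have hdiv : ∀ w, P.eval w = 1 + P.divX.eval w * w := by
    intro w
    conv_lhs => rw [← P.divX_mul_X_add]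
    rw [← coeff_zero_eq_eval_zero] at h0
    simp [h0, add_comm]
  have hQ : P.derivative.eval 0 = P.divX.eval 0 := by
    conv_lhs => rw [← P.divX_mul_X_add]
    simp
  have hlim := hY.add (((tendsto_thY.pow k).mul tendsto_lam_div_qh).mul
    ((P.divX.continuous.tendsto 0).comp tendsto_lam))
  rw [one_pow, one_mul, ← hQ] at hlim
  refine tendsto_nhds_unique (hlim.congr fun τ ↦ ?_) (tendsto_E_sub_one_div_qh hk)
  rw [hP, hdiv, Function.comp_apply]
  ring

end Values

end EvenEisenstein

end

open EvenEisenstein in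
/-- `ρ` is an arbitrary choice of representatives of the `Γ(2)`-orbits in `ℍ`. -/
theorem theorem4p3 (k : ℕ) (hk : 1 ≤ k) (ε : ℤˣ) (hε : ε = 1 → 2 ≤ k)
    (ρ : Orbits → ℍ) (hρ : ∀ x : Orbits, (Quotient.mk _ (ρ x) : Orbits) = x) :
    DifferentiableOn ℂ (E k ε) {z : ℂ | 0 < z.im} ∧
    (∀ τ : ℍ, analyticOrderAt (E k ε) (τ : ℂ) ≠ ⊤) ∧
    {x : Orbits | E k ε (ρ x : ℂ) = 0}.Finite ∧
    (2 * (Real.pi : ℂ) * Complex.I) ^ (2 * k) /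
        (4 ^ k * Complex.Gamma (2 * (k : ℂ)) * Lval k) =
      ((ε : ℤ) : ℂ) * (8 * (k : ℂ)) - ((ε : ℤ) : ℂ) * (16 *
        ∑ᶠ x : Orbits, (analyticOrderNatAt (E k ε) (ρ x : ℂ) : ℂ) * (1 / lam (ρ x : ℂ))) := by
  have hMF := isMF_E hk hε
  obtain ⟨P, hP⟩ := hMF.exists_polynomial k
  have h0 := eval_zero_eq_one hk hP
  have h1 := eval_one_ne_zero hk hP hε
  have hP0 : P ≠ 0 := by rintro rfl; simp at h0
  have hord := analyticOrderAt_eq_rootMultiplicity hP0 k hP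
  refine ⟨?_, fun τ ↦ ?_, ?_, ?_⟩
  · have h := hMF.mdiff
    rw [UpperHalfPlane.mdifferentiable_iff] at h
    exact h.congr fun z hz ↦ by simp [UpperHalfPlane.ofComplex_apply_of_im_pos hz]
  · rw [hord]
    exact ENat.natCast_ne_top _
  -- λ sends the orbits where E vanishes injectively to roots of P.
  · refine (P.roots.toFinset.finite_toSet.preimage
      (f := fun x ↦ lam (ρ x)) (lam_comp_injective hρ).injOn).subset fun x hx ↦ ?_
    have hx' : E k ε (ρ x) = 0 := hx
    rw [hP, mul_eq_zero] at hx'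
    have h2 := hx'.resolve_left (pow_ne_zero k (thY_ne_zero _))
    simpa [hP0] using h2
  · have hsum : ∑ᶠ x : Orbits, (analyticOrderNatAt (E k ε) (ρ x : ℂ) : ℂ) * (1 / lam (ρ x : ℂ)) =
        -(P.derivative.eval 0) := by
      have := finsum_rootMultiplicity hρ (P := P) (by simp [h0]) h1
      rw [h0, div_one] at this
      rw [← this]
      refine finsum_congr fun x ↦ ?_
      rw [analyticOrderNatAt, hord, ENat.toNat_natCast]
    have hd := derivative_eval_zero hk hP
    rw [hsum]
    linear_combination (-((ε : ℤ) : ℂ)) * hd - ((2 * (Real.pi : ℂ) * Complex.I) ^ (2 * k) /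
        (4 ^ k * Complex.Gamma (2 * (k : ℂ)) * Lval k)) * units_sq_cast ε
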